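/- **Setting.** For matrices of equal size let $\langle A,B\rangle=\sum_{ij}A_{ij}B_{ij}$, $\|A\|_F^2=\langle A,A\rangle$ and $\mathbf D_2(A,B)=\|A-B\|_F^2/2$; for a differentiable $\psi$ let $\mathbf\Delta_\psi(\alpha,\beta)=\psi(\alpha)-\psi(\beta)-\langle\nabla\psi(\beta),\alpha-\beta\rangle$. Let $X\in\mathbb R^{n\times p}$ be a fixed design matrix, $\sigma>0$, and $\nu$ a nonzero measure on $\mathbb R^{n\times m}$. Put $\Omega=\{\eta\in\mathbb R^{n\times m}:\int e^{\langle y,\eta\rangle/\sigma^2}d\nu(y)<\infty\}$ and $b_\nu(\eta)=\sigma^2\log\int e^{\langle y,\eta\rangle/\sigma^2}d\nu(y)$ for $\eta\in\Omega$. For $\eta\in\Omega$ let $P_\eta$ have density $\exp\{(\langle y,\eta\rangle-b_\nu(\eta))/\sigma^2\}$ with respect to $\nu$, and let $l_0(\eta;Y)=\{-\langle Y,\eta\rangle+b_\nu(\eta)\}/\sigma^2$ (note that $\mathbf\Delta_{l_0}$ does not depend on $Y$). Assume the family is regular, i.e. $\Omega$ is open. Let $$\mathcal S(q,r)=\{B\in\mathbb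 R^{p\times m}: B\text{ has at most }q\text{ distinct rows},\ \mathrm{rank}(B)\le r\},$$ where $p\ge q\ge r\ge 2$, $m\ge r$ and $r(q\wedge\mathrm{rank}(X)+m-r)\ge4$; assume $XB\in\Omega$ for all $B\in\mathcal S(q,r)$. One observes $Y\sim P_{XB^*}$ with $B^*\in\mathcal S(q,r)$; $\mathbb E$ is expectation under this law, and $\inf_{\hat B}$ is over all estimators (measurable functions $\hat B=\hat B(Y)\in\mathbb R^{p\times m}$). Call a pair of integers $(b,\zeta)$ admissible if $b\ge2$, $1\le\zeta\le r$ and $\sum_{i=0}^{\zeta}\binom ri(b-1)^i\ge q$. Put $$P(q,r)=(q+m)r+p\{\log(er)-\log\log q\}.$$ Let $I:[0,\infty)\to\mathbb R$ be nondecreasing with $I(0)=0$, $I\not\equiv0$. **Theorem.** There are constants $c,c'>0$ depending only on $I$ such that, for all $n,p,m,q,r,\sigma,\nu,X$ as above, the following hold. (a) *Estimation.* Suppose $\kappa>0$ and $\mathbf\Delta_{l_0}(0,XB)\,\sigma^2\le\kappa\|B\|_F^2/2$ for all $B\in\mathcal S(q,r)$. Then for every admissible $(b,\zeta)$ $$\inf_{\hat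 B}\sup_{B^*\in\mathcal S(q,r)}\mathbb E\,I\Big(\|B^*-\hat B\|_F^2\Big/\Big[c\,\sigma^2\Big\{(q+m)r+\frac{p\log q}{b^2\zeta}\Big\}/\kappa\Big]\Big)\ge c',$$ and, if $8\le q\le e^r$, $$\inf_{\hat B}\sup_{B^*\in\mathcal S(q,r)}\mathbb E\,I\big(\|B^*-\hat B\|_F^2/\{c\,\sigma^2P(q,r)/\kappa\}\big)\ge c'.$$ (b) *Prediction.* Let $\underline\kappa,\overline\kappa>0$. (b1) Suppose $q\le\mathrm{rank}(X)$ and, for all $B_1,B_2\in\mathcal S(q,r)$, $\underline\kappa\,\mathbf D_2(B_1,B_2)\le\mathbf D_2(XB_1,XB_2)$ and $\mathbf\Delta_{l_0}(0,XB_1)\sigma^2\le\overline\kappa\,\mathbf D_2(0,B_1)$. Then for every admissible $(b,\zeta)$ $$\inf_{\hat B}\sup_{B^*\in\mathcal S(q,r)}\mathbb E\,I\Big(\|XB^*-X\hat B\|_F^2\Big/\Big[c\,\frac{\underline\kappa}{\overline\kappa}\,\sigma^2\Big\{(q+m)r+\frac{p\log q}{b^2\zeta}\Big\}\Big]\Big)\ge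 c'.$$ (b2) Suppose $r\le\mathrm{rank}(X)<q$, let $X=UDV^T$ be a compact singular value decomposition ($U,V$ with $\mathrm{rank}(X)$ orthonormal columns, $D$ diagonal with positive diagonal entries), $Z=UD$, and suppose that, for all $C_1,C_2\in\mathbb R^{\mathrm{rank}(X)\times m}$ of rank at most $r$, $\underline\kappa\,\mathbf D_2(C_1,C_2)\le\mathbf D_2(ZC_1,ZC_2)$ and $\mathbf\Delta_{l_0}(0,ZC_1)\sigma^2\le\overline\kappa\,\mathbf D_2(0,C_1)$. Then $$\inf_{\hat B}\sup_{B^*\in\mathcal S(q,r)}\mathbb E\,I\Big(\|XB^*-X\hat B\|_F^2\Big/\Big[c\,\frac{\underline\kappa}{\overline\kappa}\,\sigma^2(\mathrm{rank}(X)+m)r\Big]\Big)\ge c'.$$ (b3) Moreover there is a universal constant $c_0>0$ such that, in the situation of (b1) with in addition $8\le q\le e^r$, $$\inf_{\hat B}\sup_{B^*\in\mathcal S(q,r)}\mathbb E\|XB^*-X\hat B\|_F^2\ge c_0\,\frac{\underline\kappa}{\overline\kappa}\,\sigma^2P(q,r).$$ -/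

import Mathlib

open MeasureTheory
open scoped ENNReal

noncomputable section

namespace CRL

variable {n p m : ℕ}

/-- The trace inner product `⟨A, B⟩ = ∑ᵢⱼ Aᵢⱼ Bᵢⱼ`. -/
def frobInner (A B : Matrix (Fin n) (Fin m) ℝ) : ℝ :=
  ∑ i, ∑ j, A i j * B i j

/-- The squared Frobenius norm `‖A‖_F²`. -/
def frobSq (A : Matrix (Fin n) (Fin m) ℝ) : ℝ :=
  ∑ i, ∑ j, A i j ^ 2

/-- `D₂(A, B) = ‖A - B‖_F² / 2`. -/
def D₂ (A B : Matrix (Fin n) (Fin m) ℝ) : ℝ :=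
  frobSq (A - B) / 2

/-- The generalized Bregman function
`Δ_ψ(α, β) = ψ(α) - ψ(β) - ⟨∇ψ(β), α - β⟩`; the last term is the Fréchet derivative of `ψ` at `β`
in the direction `α - β`. -/
def bregman (ψ : Matrix (Fin n) (Fin m) ℝ → ℝ) (α β : Matrix (Fin n) (Fin m) ℝ) : ℝ :=
  ψ α - ψ β - fderiv ℝ ψ β (α - β)

/-- The number of distinct rows of `B`. -/
def numDistinctRows (B : Matrix (Fin p) (Fin m) ℝ) : ℕ :=
  (Set.range fun i : Fin p => B.row i).ncard

/-- The signal class `S(q, r)`. -/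
def signalClass (p m q r : ℕ) : Set (Matrix (Fin p) (Fin m) ℝ) :=
  {B | numDistinctRows B ≤ q ∧ B.rank ≤ r}

/-- Matrices carry the product (equivalently Borel) `σ`-algebra of their entries. -/
instance instMeasurableSpaceMatrix : MeasurableSpace (Matrix (Fin n) (Fin m) ℝ) :=
  inferInstanceAs (MeasurableSpace (Fin n → Fin m → ℝ))

/-- The natural parameter space `Ω = {η : ∫ exp(⟨y, η⟩ / σ²) dν(y) < ∞}` of the exponential
dispersion family with base measure `ν` and dispersion `σ²`. -/
def naturalSpace (ν : Measure (Matrix (Fin n) (Fin m) ℝ)) (σ : ℝ) :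
    Set (Matrix (Fin n) (Fin m) ℝ) :=
  {η | Integrable (fun y => Real.exp (frobInner y η / σ ^ 2)) ν}

/-- The cumulant function `b(η) = σ² log ∫ exp(⟨y, η⟩ / σ²) dν(y)`, i.e. the function which makes
`exp((⟨y, η⟩ - b(η)) / σ²)` a probability density with respect to `ν`. -/
def cumulant (ν : Measure (Matrix (Fin n) (Fin m) ℝ)) (σ : ℝ) (η : Matrix (Fin n) (Fin m) ℝ) : ℝ :=
  σ ^ 2 * Real.log (∫ y, Real.exp (frobInner y η / σ ^ 2) ∂ν)

/-- The law of `Y` with systematic component `η`: density `exp((⟨y, η⟩ - b(η)) / σ²)` with respect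
to the base measure `ν`. -/
def glmLaw (ν : Measure (Matrix (Fin n) (Fin m) ℝ)) (σ : ℝ) (η : Matrix (Fin n) (Fin m) ℝ) :
    Measure (Matrix (Fin n) (Fin m) ℝ) :=
  ν.withDensity fun y =>
    ENNReal.ofReal (Real.exp ((frobInner y η - cumulant ν σ η) / σ ^ 2))

/-- The scaled negative log-likelihood `l₀(η; Y) = (-⟨Y, η⟩ + b(η)) / σ²`. -/
def glmLoss (ν : Measure (Matrix (Fin n) (Fin m) ℝ)) (σ : ℝ) (Y η : Matrix (Fin n) (Fin m) ℝ) : ℝ :=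
  (-frobInner Y η + cumulant ν σ η) / σ ^ 2

/-- The standing model: for every coefficient matrix of the signal class, `Y` given `X B` follows
the exponential family with base measure `ν` and dispersion `σ²`; the family is regular (its
natural parameter space is open), and the dimensions satisfy the standing restrictions. -/
structure IsModel (q r : ℕ) (σ : ℝ) (ν : Measure (Matrix (Fin n) (Fin m) ℝ))
    (X : Matrix (Fin n) (Fin p) ℝ) : Prop where
  two_le_r : 2 ≤ r
  r_le_q : r ≤ q
  q_le_p : q ≤ p
  r_le_m : r ≤ m
  dim : 4 ≤ r * (min q X.rank + m - r)
  σ_pos : 0 < σ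
  ν_ne_zero : ν ≠ 0
  regular : IsOpen (naturalSpace ν σ)
  mem_naturalSpace : ∀ B ∈ signalClass p m q r, X * B ∈ naturalSpace ν σ

/-- The admissible pairs of integers: `b ≥ 2`, `1 ≤ ζ ≤ r` and `∑_{i ≤ ζ} C(r, i) (b - 1)^i ≥ q`. -/
def Admissible (q r b ζ : ℕ) : Prop :=
  2 ≤ b ∧ 1 ≤ ζ ∧ ζ ≤ r ∧ q ≤ ∑ i ∈ Finset.range (ζ + 1), r.choose i * (b - 1) ^ i

/-- The general rate `(q + m) r + p log q / (b² ζ)`. -/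
def generalRate (p m q r b ζ : ℕ) : ℝ :=
  ((q : ℝ) + m) * r + p * Real.log q / ((b : ℝ) ^ 2 * ζ)

/-- The complexity function `P(q, r) = (q + m) r + p {log(e r) - log log q}`. -/
def complexityP (p m q r : ℕ) : ℝ :=
  ((q : ℝ) + m) * r + p * (Real.log (Real.exp 1 * r) - Real.log (Real.log q))

/-- A compact singular value decomposition `X = U D Vᵀ`: `U` and `V` have `rank X` orthonormal
columns and `D = diag(d)` with positive entries. -/
structure IsCompactSVD (X : Matrix (Fin n) (Fin p) ℝ) (U : Matrix (Fin n) (Fin X.rank) ℝ)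
    (d : Fin X.rank → ℝ) (V : Matrix (Fin p) (Fin X.rank) ℝ) : Prop where
  U_orth : U.transpose * U = 1
  V_orth : V.transpose * V = 1
  d_pos : ∀ i, 0 < d i
  eq : X = U * Matrix.diagonal d * V.transpose

/-- An arbitrary loss function `I : [0, ∞) → ℝ`: nondecreasing, `I(0) = 0` and `I ≢ 0`
(values of `I` at negative arguments play no role). -/
structure IsLossFunction (I : ℝ → ℝ) : Prop where
  mono : MonotoneOn I (Set.Ici 0)
  zero : I 0 = 0
  nontrivial : ∃ t, 0 ≤ t ∧ I t ≠ 0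

/-- The minimax risk `inf_{B̂} sup_{B ∈ S(q, r)} E_B [ℓ(B, B̂(Y))]`, where the infimum is over all
estimators, i.e. measurable functions of the data `Y`, and `Y` has law `P_{XB}`. -/
def minimaxRisk (q r : ℕ) (σ : ℝ) (ν : Measure (Matrix (Fin n) (Fin m) ℝ))
    (X : Matrix (Fin n) (Fin p) ℝ)
    (ℓ : Matrix (Fin p) (Fin m) ℝ → Matrix (Fin p) (Fin m) ℝ → ℝ) : ℝ≥0∞ :=
  ⨅ (Bhat : Matrix (Fin n) (Fin m) ℝ → Matrix (Fin p) (Fin m) ℝ) (_ : Measurable Bhat),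
    ⨆ B ∈ signalClass p m q r, ∫⁻ Y, ENNReal.ofReal (ℓ B (Bhat Y)) ∂(glmLaw ν σ (X * B))

/-- The restricted curvature condition `Δ_{l₀}(0, X B) σ² ≤ κ D₂(0, B)` on a class of matrices
(`Δ_{l₀(·; Y)}` does not depend on `Y`). -/
def CurvatureBound {k : ℕ} (σ : ℝ) (ν : Measure (Matrix (Fin n) (Fin m) ℝ))
    (X : Matrix (Fin n) (Fin k) ℝ) (S : Set (Matrix (Fin k) (Fin m) ℝ)) (κ : ℝ) : Prop :=
  ∀ B ∈ S, ∀ Y, bregman (glmLoss ν σ Y) 0 (X * B) * σ ^ 2 ≤ κ * D₂ 0 B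

/-- The restricted condition-number condition on a class of matrices, with constants `κlo`, `κhi`. -/
structure CondNumberBound {k : ℕ} (σ : ℝ) (ν : Measure (Matrix (Fin n) (Fin m) ℝ))
    (X : Matrix (Fin n) (Fin k) ℝ) (S : Set (Matrix (Fin k) (Fin m) ℝ)) (κlo κhi : ℝ) : Prop where
  lo_pos : 0 < κlo
  hi_pos : 0 < κhi
  lower : ∀ B₁ ∈ S, ∀ B₂ ∈ S, κlo * D₂ B₁ B₂ ≤ D₂ (X * B₁) (X * B₂)
  upper : CurvatureBound σ ν X S κhi

end CRL

end

/-! The bound is a many-hypotheses test against the single reference law `P_0`. In an exponential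
family the Bregman divergence of the negative log-likelihood, `Δ_{l₀}(0, η)`, is the
Kullback-Leibler divergence of `P_η` from `P_0` (`bregman_glmLoss_eq`), so the curvature condition
bounds the divergence of `P_{XB}` from `P_0` by `κ ‖B‖² / (2σ²)`.

Take `M` signals, pairwise separated in the loss, each with divergence at most `log M / 8`. The
events "the estimate is close to signal `j`" are disjoint, so one of them has `P_0`-probability at
most `1/M`. A change-of-measure inequality (`log_mul_measure_le`, `measure_le_of_bregman_le`) then
bounds its probability under the law of signal `j` itself by `7/8`. The estimator thus misses signal
`j` with probability at least `1/8` (`le_minimaxRisk_of_separated`).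

It remains to find large separated families of small norm, a property recorded by `HasPacking`. All
come from a `Q`-ary Gilbert-Varshamov bound (`exists_hamming_packing`). Binary words filling a block
of `q - 1` rows and `r` columns give `qr`; a block of `r - 1` rows and `m` columns gives `mr`. Words
of length `p` over `q` letters, each letter naming a row of a dictionary of short integer vectors,
give `p log q / (b² ζ)`; admissibility says exactly that enough sparse vectors exist for the
dictionary. The choice `b = 10`, `ζ ≈ log q / log(e r / log q)` turns this rate into a multiple of
`P(q, r)`. -/

open MeasureTheory
open scoped ENNReal

noncomputable section

namespace CRL

variable {n p m : ℕ}

/-! ### Differentiating the partition function under the integral sign -/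

section PartitionFunction

/-- Matrices viewed as families of entries, with the supremum norm. -/
abbrev EntrySpace (n m : ℕ) : Type := Fin n → Fin m → ℝ

/-- The trace inner product on families of entries. -/
def pairing (y η : EntrySpace n m) : ℝ := ∑ i, ∑ j, y i j * η i j

/-- The trace inner product as a linear map into the continuous dual. -/
def pairingCLM : EntrySpace n m →ₗ[ℝ] (EntrySpace n m →L[ℝ] ℝ) where
  toFun y := LinearMap.toContinuousLinearMap (𝕜 := ℝ)
    { toFun := fun η => pairing y η
      map_add' := fun a b => by
        simp only [pairing, Pi.add_apply, mul_add, Finset.sum_add_distrib]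
      map_smul' := fun c a => by
        simp only [pairing, Pi.smul_apply, smul_eq_mul, Finset.mul_sum, RingHom.id_apply]
        exact Finset.sum_congr rfl fun i _ => Finset.sum_congr rfl fun j _ => by ring }
  map_add' a b := by
    ext η
    simp [pairing, add_mul, Finset.sum_add_distrib]
  map_smul' c a := by
    ext η
    simp [pairing, Finset.mul_sum, mul_assoc]

@[simp]
theorem pairingCLM_apply (y η : EntrySpace n m) : pairingCLM y η = pairing y η := rfl

theorem continuous_pairingCLM :
    Continuous (pairingCLM : EntrySpace n m → (EntrySpace n m →L[ℝ] ℝ)) :=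
  LinearMap.continuous_of_finiteDimensional _

theorem measurable_pairing (η : EntrySpace n m) :
    Measurable fun y : EntrySpace n m => pairing y η := by
  have h : Continuous fun y : EntrySpace n m => pairingCLM y η :=
    continuous_pairingCLM.clm_apply continuous_const
  exact h.measurable

theorem pairing_add_right (y a b : EntrySpace n m) :
    pairing y (a + b) = pairing y a + pairing y b :=
  (pairingCLM y).map_add a b

/-- The entrywise `ℓ¹` norm. -/
def entrySum (y : EntrySpace n m) : ℝ := ∑ i, ∑ j, |y i j|

theorem entrySum_nonneg (y : EntrySpace n m) : 0 ≤ entrySum y :=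
  Finset.sum_nonneg fun _ _ => Finset.sum_nonneg fun _ _ => abs_nonneg _

theorem abs_pairing_le (y η : EntrySpace n m) :
    |pairing y η| ≤ entrySum y * ‖η‖ := by
  unfold pairing entrySum
  rw [Finset.sum_mul]
  refine (Finset.abs_sum_le_sum_abs _ _).trans (Finset.sum_le_sum fun i _ => ?_)
  rw [Finset.sum_mul]
  refine (Finset.abs_sum_le_sum_abs _ _).trans (Finset.sum_le_sum fun j _ => ?_)
  rw [abs_mul]
  exact mul_le_mul_of_nonneg_left ((norm_le_pi_norm (η i) j).trans (norm_le_pi_norm η i))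
    (abs_nonneg _)

theorem norm_pairingCLM_le (y : EntrySpace n m) : ‖pairingCLM y‖ ≤ entrySum y :=
  ContinuousLinearMap.opNorm_le_bound _ (entrySum_nonneg y) fun η => abs_pairing_le y η

/-- The matrix with entries `±t` according to a sign pattern. -/
def signMatrix (t : ℝ) (s : Fin n → Fin m → Bool) : EntrySpace n m :=
  fun i j => if s i j then t else -t

theorem norm_signMatrix_le {t : ℝ} (ht : 0 ≤ t) (s : Fin n → Fin m → Bool) :
    ‖signMatrix t s‖ ≤ t := by
  refine (pi_norm_le_iff_of_nonneg ht).2 fun i => (pi_norm_le_iff_of_nonneg ht).2 fun j => ?_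
  simp only [signMatrix]
  split_ifs <;> simp [abs_of_nonneg ht]

theorem exists_pairing_signMatrix (t : ℝ) (y : EntrySpace n m) :
    ∃ s, pairing y (signMatrix t s) = t * entrySum y := by
  refine ⟨fun i j => decide (0 ≤ y i j), ?_⟩
  simp only [pairing, entrySum, Finset.mul_sum, signMatrix]
  refine Finset.sum_congr rfl fun i _ => Finset.sum_congr rfl fun j _ => ?_
  by_cases h : 0 ≤ y i j
  · simp [h, abs_of_nonneg h, mul_comm]
  · simp [h, abs_of_neg (not_le.1 h), mul_comm]

variable {ν : Measure (EntrySpace n m)} {σ : ℝ} {η : EntrySpace n m}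

/-- Each `y` pairs with a suitable sign matrix to give its full `ℓ¹` norm, so `exp` of that norm is
dominated by a finite sum over sign patterns, integrable because `Ω` is open. The rate is `2 * ε`
because the derivative needs the room twice: once for moving the parameter within an `ε`-ball, once
for absorbing the linear factor by `s ≤ ε⁻¹ exp(ε s)`. -/
theorem exists_integrable_dominating
    (hΩ : IsOpen {x : EntrySpace n m | Integrable (fun y => Real.exp (pairing y x / σ ^ 2)) ν})
    (hη : Integrable (fun y => Real.exp (pairing y η / σ ^ 2)) ν) :
    ∃ ε : ℝ, 0 < ε ∧ Integrable
      (fun y => Real.exp (pairing y η / σ ^ 2) * Real.exp (2 * ε * entrySum y / σ ^ 2)) ν := by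
  obtain ⟨δ, hδ, hball⟩ := Metric.isOpen_iff.1 hΩ η hη
  -- The sign matrices then have norm at most `δ / 2`, so the shifted parameters stay in the
  -- `δ`-ball inside `Ω`.
  refine ⟨δ / 4, by positivity, ?_⟩
  have hint : Integrable (fun y => ∑ s : Fin n → Fin m → Bool,
      Real.exp (pairing y (η + signMatrix (2 * (δ / 4)) s) / σ ^ 2)) ν := by
    refine integrable_finsetSum _ fun s _ => ?_
    have : η + signMatrix (2 * (δ / 4)) s ∈
        {x : EntrySpace n m | Integrable (fun y => Real.exp (pairing y x / σ ^ 2)) ν} := by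
      apply hball
      rw [Metric.mem_ball, dist_eq_norm, add_sub_cancel_left]
      refine (norm_signMatrix_le (by positivity) s).trans_lt (by linarith)
    exact this
  refine hint.mono' ?_ (Filter.Eventually.of_forall fun y => ?_)
  · have h1 : Measurable fun y : EntrySpace n m => entrySum y := by
      have : Continuous fun y : EntrySpace n m => entrySum y := by
        unfold entrySum; fun_prop
      exact this.measurable
    have h2 := measurable_pairing (n := n) (m := m) η
    exact Measurable.aestronglyMeasurable (by fun_prop)
  · obtain ⟨s, hs⟩ := exists_pairing_signMatrix (2 * (δ / 4)) y
    rw [Real.norm_of_nonneg (by positivity), ← Real.exp_add]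
    refine le_trans (le_of_eq ?_) (Finset.single_le_sum
      (f := fun s => Real.exp (pairing y (η + signMatrix (2 * (δ / 4)) s) / σ ^ 2))
      (fun s _ => (Real.exp_pos _).le) (Finset.mem_univ s))
    rw [pairing_add_right, hs, add_div]

theorem hasFDerivAt_partition (hσ : 0 < σ)
    (hΩ : IsOpen {x : EntrySpace n m | Integrable (fun y => Real.exp (pairing y x / σ ^ 2)) ν})
    (hη : Integrable (fun y => Real.exp (pairing y η / σ ^ 2)) ν) :
    ∃ D : EntrySpace n m →L[ℝ] ℝ,
      HasFDerivAt (fun x => ∫ y, Real.exp (pairing y x / σ ^ 2) ∂ν) D η ∧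
      (∀ h, Integrable (fun y => Real.exp (pairing y η / σ ^ 2) * (1 / σ ^ 2 * pairing y h)) ν) ∧
      ∀ h, D h = ∫ y, Real.exp (pairing y η / σ ^ 2) * (1 / σ ^ 2 * pairing y h) ∂ν := by
  obtain ⟨ε, hε, hint⟩ := exists_integrable_dominating hΩ hη
  have hσ2 : 0 < σ ^ 2 := by positivity
  have hmeas : AEStronglyMeasurable
      (fun y => Real.exp (pairing y η / σ ^ 2) • ((1 / σ ^ 2) • pairingCLM y)) ν := by
    have hc : Continuous fun y : EntrySpace n m =>
        Real.exp (pairing y η / σ ^ 2) • ((1 / σ ^ 2) • pairingCLM y) := by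
      have h : Continuous fun y : EntrySpace n m => pairing y η :=
        continuous_pairingCLM.clm_apply continuous_const
      have h' := continuous_pairingCLM (n := n) (m := m)
      fun_prop
    exact hc.aestronglyMeasurable
  have hbound : ∀ y : EntrySpace n m, ∀ x ∈ Metric.ball η ε,
      ‖Real.exp (pairing y x / σ ^ 2) • ((1 / σ ^ 2) • pairingCLM y)‖ ≤
        ε⁻¹ * (Real.exp (pairing y η / σ ^ 2) * Real.exp (2 * ε * entrySum y / σ ^ 2)) := by
    intro y x hx
    have hS := entrySum_nonneg y
    have h1 : pairing y x ≤ pairing y η + ε * entrySum y := by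
      have : pairing y x = pairing y η + pairing y (x - η) := by
        rw [← pairing_add_right, add_sub_cancel]
      rw [this]
      have h2 := (le_abs_self _).trans (abs_pairing_le y (x - η))
      rw [Metric.mem_ball, dist_eq_norm] at hx
      nlinarith
    have h3 : entrySum y / σ ^ 2 ≤ ε⁻¹ * Real.exp (ε * entrySum y / σ ^ 2) := by
      have := Real.add_one_le_exp (ε * entrySum y / σ ^ 2)
      have h4 : entrySum y / σ ^ 2 = ε⁻¹ * (ε * entrySum y / σ ^ 2) := by field_simp
      rw [h4]
      gcongr
      linarith
    rw [norm_smul, norm_smul, Real.norm_of_nonneg (Real.exp_pos _).le,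
      Real.norm_of_nonneg (by positivity)]
    calc Real.exp (pairing y x / σ ^ 2) * (1 / σ ^ 2 * ‖pairingCLM y‖)
        ≤ Real.exp ((pairing y η + ε * entrySum y) / σ ^ 2) * (entrySum y / σ ^ 2) := by
          rw [one_div_mul_eq_div]
          gcongr
          exact norm_pairingCLM_le y
      _ ≤ Real.exp ((pairing y η + ε * entrySum y) / σ ^ 2) *
          (ε⁻¹ * Real.exp (ε * entrySum y / σ ^ 2)) := by gcongr
      _ = _ := by
          rw [mul_left_comm, ← Real.exp_add, ← Real.exp_add]
          congr 2
          ring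
  have hi := (hint.const_mul ε⁻¹).mono' hmeas
    (Filter.Eventually.of_forall fun y => hbound y η (Metric.mem_ball_self hε))
  refine ⟨∫ y, Real.exp (pairing y η / σ ^ 2) • ((1 / σ ^ 2) • pairingCLM y) ∂ν, ?_,
    fun h => hi.apply_continuousLinearMap h, fun h => ContinuousLinearMap.integral_apply hi h⟩
  refine hasFDerivAt_integral_of_dominated_of_fderiv_le (Metric.ball_mem_nhds η hε)
    (Filter.Eventually.of_forall fun x => ?_) hη hmeas
    (Filter.Eventually.of_forall hbound) (hint.const_mul ε⁻¹)
    (Filter.Eventually.of_forall fun y x _ => ?_)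
  · have h2 := measurable_pairing (n := n) (m := m) x
    exact Measurable.aestronglyMeasurable (by fun_prop)
  · have h : HasFDerivAt (fun x => pairing y x / σ ^ 2) ((1 / σ ^ 2) • pairingCLM y) x := by
      have h' : (fun x => pairing y x / σ ^ 2) = ⇑((1 / σ ^ 2) • pairingCLM y) := by
        ext x
        simp [div_eq_inv_mul]
      rw [h']
      exact ContinuousLinearMap.hasFDerivAt _
    exact h.exp

theorem hasFDerivAt_log_partition (hσ : 0 < σ) (hν : ν ≠ 0)
    (hΩ : IsOpen {x : EntrySpace n m | Integrable (fun y => Real.exp (pairing y x / σ ^ 2)) ν})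
    (hη : Integrable (fun y => Real.exp (pairing y η / σ ^ 2)) ν) :
    ∃ D : EntrySpace n m →L[ℝ] ℝ,
      HasFDerivAt (fun x => Real.log (∫ y, Real.exp (pairing y x / σ ^ 2) ∂ν)) D η ∧
      (∀ h, Integrable (fun y => Real.exp (pairing y η / σ ^ 2) * (1 / σ ^ 2 * pairing y h)) ν) ∧
      ∀ h, D h = (∫ y, Real.exp (pairing y η / σ ^ 2) ∂ν)⁻¹ *
        ∫ y, Real.exp (pairing y η / σ ^ 2) * (1 / σ ^ 2 * pairing y h) ∂ν := by
  obtain ⟨D, hd, hi, hD⟩ := hasFDerivAt_partition hσ hΩ hη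
  have : NeZero ν := ⟨hν⟩
  refine ⟨_, hd.log (integral_exp_pos hη).ne', hi, fun h => ?_⟩
  rw [smul_apply, hD, smul_eq_mul]

end PartitionFunction

/-! ### Bregman divergence as Kullback-Leibler divergence; change of measure -/

section ExponentialFamilyLaw

variable {ν : Measure (Matrix (Fin n) (Fin m) ℝ)} {σ : ℝ} {η : Matrix (Fin n) (Fin m) ℝ}

theorem measurable_frobInner (η : Matrix (Fin n) (Fin m) ℝ) :
    Measurable fun y : Matrix (Fin n) (Fin m) ℝ => frobInner y η :=
  measurable_pairing (n := n) (m := m) η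

theorem frobInner_zero_right (y : Matrix (Fin n) (Fin m) ℝ) : frobInner y 0 = 0 := by
  simp [frobInner]

theorem frobInner_zero_left (η : Matrix (Fin n) (Fin m) ℝ) : frobInner 0 η = 0 := by
  simp [frobInner]

/-- Transfer from families of entries, where the supremum norm serves for the estimates, to
matrices, by definitional unfolding. -/
theorem hasFDerivAt_log_matrix_partition (hσ : 0 < σ) (hν : ν ≠ 0)
    (hΩ : IsOpen (naturalSpace ν σ)) (hη : η ∈ naturalSpace ν σ) :
    ∃ D : Matrix (Fin n) (Fin m) ℝ →L[ℝ] ℝ,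
      HasFDerivAt (fun x => Real.log (∫ y, Real.exp (frobInner y x / σ ^ 2) ∂ν)) D η ∧
      (∀ h, Integrable
        (fun y => Real.exp (frobInner y η / σ ^ 2) * (1 / σ ^ 2 * frobInner y h)) ν) ∧
      ∀ h, D h = (∫ y, Real.exp (frobInner y η / σ ^ 2) ∂ν)⁻¹ *
        ∫ y, Real.exp (frobInner y η / σ ^ 2) * (1 / σ ^ 2 * frobInner y h) ∂ν :=
  hasFDerivAt_log_partition (n := n) (m := m) (ν := ν) hσ hν hΩ hη

theorem partition_pos (hν : ν ≠ 0) (hη : η ∈ naturalSpace ν σ) :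
    0 < ∫ y, Real.exp (frobInner y η / σ ^ 2) ∂ν := by
  have : NeZero ν := ⟨hν⟩
  exact integral_exp_pos hη

theorem density_eq (hσ : 0 < σ) (hν : ν ≠ 0) (hη : η ∈ naturalSpace ν σ)
    (y : Matrix (Fin n) (Fin m) ℝ) :
    Real.exp ((frobInner y η - cumulant ν σ η) / σ ^ 2) =
      Real.exp (frobInner y η / σ ^ 2) / ∫ y, Real.exp (frobInner y η / σ ^ 2) ∂ν := by
  rw [sub_div, Real.exp_sub, cumulant, mul_div_cancel_left₀ _ (by positivity),
    Real.exp_log (partition_pos hν hη)]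

theorem measurable_density (ν : Measure (Matrix (Fin n) (Fin m) ℝ)) (σ : ℝ)
    (η : Matrix (Fin n) (Fin m) ℝ) :
    Measurable fun y => Real.exp ((frobInner y η - cumulant ν σ η) / σ ^ 2) := by
  have := measurable_frobInner (n := n) (m := m) η
  fun_prop

theorem integral_glmLaw (f : Matrix (Fin n) (Fin m) ℝ → ℝ) :
    ∫ y, f y ∂(glmLaw ν σ η) =
      ∫ y, Real.exp ((frobInner y η - cumulant ν σ η) / σ ^ 2) * f y ∂ν := by
  rw [glmLaw, integral_withDensity_eq_integral_toReal_smul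
    (measurable_density ν σ η).ennreal_ofReal (Filter.Eventually.of_forall fun _ => by simp)]
  refine integral_congr_ae (Filter.Eventually.of_forall fun y => ?_)
  simp [ENNReal.toReal_ofReal (Real.exp_pos _).le]

theorem integrable_glmLaw_iff (f : Matrix (Fin n) (Fin m) ℝ → ℝ) :
    Integrable f (glmLaw ν σ η) ↔
      Integrable (fun y => Real.exp ((frobInner y η - cumulant ν σ η) / σ ^ 2) * f y) ν := by
  rw [glmLaw, integrable_withDensity_iff_integrable_smul'
    (measurable_density ν σ η).ennreal_ofReal (Filter.Eventually.of_forall fun _ => by simp)]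
  simp [ENNReal.toReal_ofReal (Real.exp_pos _).le]

theorem isProbabilityMeasure_glmLaw (hσ : 0 < σ) (hν : ν ≠ 0) (hη : η ∈ naturalSpace ν σ) :
    IsProbabilityMeasure (glmLaw ν σ η) := by
  constructor
  rw [glmLaw, withDensity_apply _ MeasurableSet.univ, Measure.restrict_univ,
    ← ofReal_integral_eq_lintegral_ofReal]
  · simp_rw [density_eq hσ hν hη, integral_div]
    rw [div_self (partition_pos hν hη).ne', ENNReal.ofReal_one]
  · simp_rw [density_eq hσ hν hη]
    exact hη.div_const _
  · exact Filter.Eventually.of_forall fun _ => (Real.exp_pos _).le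

theorem integrable_frobInner_glmLaw (hσ : 0 < σ) (hν : ν ≠ 0) (hΩ : IsOpen (naturalSpace ν σ))
    (hη : η ∈ naturalSpace ν σ) (h : Matrix (Fin n) (Fin m) ℝ) :
    Integrable (fun y => frobInner y h) (glmLaw ν σ η) := by
  obtain ⟨-, -, hi, -⟩ := hasFDerivAt_log_matrix_partition hσ hν hΩ hη
  rw [integrable_glmLaw_iff]
  refine ((hi h).const_mul (σ ^ 2 / ∫ y, Real.exp (frobInner y η / σ ^ 2) ∂ν)).congr
    (Filter.Eventually.of_forall fun y => ?_)
  have hp := partition_pos hν hη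
  simp only [density_eq hσ hν hη]
  field_simp

/-- The data point may be set to `0`, since the linear term of the loss cancels in the Bregman
divergence. What remains is the log-partition function, whose gradient is the mean of the family
divided by `σ ^ 2`. -/
theorem hasFDerivAt_glmLoss_zero (hσ : 0 < σ) (hν : ν ≠ 0) (hΩ : IsOpen (naturalSpace ν σ))
    (hη : η ∈ naturalSpace ν σ) :
    ∃ D : Matrix (Fin n) (Fin m) ℝ →L[ℝ] ℝ, HasFDerivAt (glmLoss ν σ 0) D η ∧
      ∀ h, D h = (∫ y, frobInner y h ∂(glmLaw ν σ η)) / σ ^ 2 := by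
  obtain ⟨D, hd, hi, hD⟩ := hasFDerivAt_log_matrix_partition hσ hν hΩ hη
  have hl : glmLoss ν σ 0 = fun x => Real.log (∫ y, Real.exp (frobInner y x / σ ^ 2) ∂ν) := by
    ext x
    rw [glmLoss, frobInner_zero_left, neg_zero, zero_add, cumulant,
      mul_div_cancel_left₀ _ (by positivity)]
  refine ⟨D, hl ▸ hd, fun h => ?_⟩
  rw [integral_glmLaw, hD, ← integral_const_mul, ← integral_div]
  refine integral_congr_ae (Filter.Eventually.of_forall fun y => ?_)
  simp only [density_eq hσ hν hη]
  field_simp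

/-- The Bregman divergence of the negative log-likelihood is the Kullback-Leibler divergence. -/
theorem bregman_glmLoss_eq (hσ : 0 < σ) (hν : ν ≠ 0) (hΩ : IsOpen (naturalSpace ν σ))
    (hη : η ∈ naturalSpace ν σ) :
    bregman (glmLoss ν σ 0) 0 η =
      ∫ y, (frobInner y η - cumulant ν σ η + cumulant ν σ 0) / σ ^ 2 ∂(glmLaw ν σ η) := by
  have := isProbabilityMeasure_glmLaw hσ hν hη
  have hint := integrable_frobInner_glmLaw hσ hν hΩ hη η
  obtain ⟨D, hD, hDa⟩ := hasFDerivAt_glmLoss_zero hσ hν hΩ hη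
  rw [bregman, hD.fderiv, zero_sub, map_neg, hDa, integral_div,
    integral_add (f := fun y => frobInner y η - cumulant ν σ η) (hint.sub (integrable_const _))
      (integrable_const _),
    integral_sub hint (integrable_const _)]
  simp only [integral_const, probReal_univ, smul_eq_mul, glmLoss, frobInner_zero_left]
  ring

/-- A Donsker-Varadhan type bound: an event which is unlikely under `P₀` is not too likely under a
`P_η` that is close to `P₀` in Kullback-Leibler divergence. -/
theorem log_mul_measure_le (hσ : 0 < σ) (hν : ν ≠ 0) (hΩ : IsOpen (naturalSpace ν σ))
    (hη : η ∈ naturalSpace ν σ) (h0 : (0 : Matrix (Fin n) (Fin m) ℝ) ∈ naturalSpace ν σ)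
    {A : Set (Matrix (Fin n) (Fin m) ℝ)} (hA : MeasurableSet A) (t : ℝ) :
    t * (glmLaw ν σ η).real A ≤ bregman (glmLoss ν σ 0) 0 η +
      Real.log (1 + (Real.exp t - 1) * (glmLaw ν σ 0).real A) := by
  have hP := isProbabilityMeasure_glmLaw hσ hν hη
  have hP0 := isProbabilityMeasure_glmLaw hσ hν h0
  have hint := integrable_frobInner_glmLaw hσ hν hΩ hη η
  set Z : Matrix (Fin n) (Fin m) ℝ → ℝ :=
    fun y => (frobInner y η - cumulant ν σ η + cumulant ν σ 0) / σ ^ 2 with hZ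
  have hZi : Integrable Z (glmLaw ν σ η) :=
    ((hint.sub (integrable_const _)).add (integrable_const _)).div_const _
  have hAi : ∀ P : Measure (Matrix (Fin n) (Fin m) ℝ), IsProbabilityMeasure P → ∀ c : ℝ,
      Integrable (A.indicator fun _ => c) P := fun P _ c => (integrable_const c).indicator hA
  have hgi : Integrable (fun y => A.indicator (fun _ => t) y - Z y) (glmLaw ν σ η) :=
    (hAi _ hP t).sub hZi
  -- `Z` is the log-likelihood ratio of `P_η` to `P_0`, so the factor `exp(-Z)` turns the density of
  -- `P_η` into that of `P_0`.
  have hkey : ∀ y, Real.exp ((frobInner y η - cumulant ν σ η) / σ ^ 2) *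
      Real.exp (A.indicator (fun _ => t) y - Z y) =
      Real.exp ((frobInner y 0 - cumulant ν σ 0) / σ ^ 2) *
        (1 + A.indicator (fun _ => Real.exp t - 1) y) := by
    intro y
    have : 1 + A.indicator (fun _ => Real.exp t - 1) y =
        Real.exp (A.indicator (fun _ => t) y) := by
      by_cases hy : y ∈ A <;> simp [hy]
    rw [this, ← Real.exp_add, ← Real.exp_add, hZ, frobInner_zero_right]
    congr 1
    ring
  have hE0 : Integrable (fun y => 1 + A.indicator (fun _ => Real.exp t - 1) y) (glmLaw ν σ 0) :=
    (integrable_const _).add (hAi _ hP0 _)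
  have hei : Integrable (fun y => Real.exp (A.indicator (fun _ => t) y - Z y)) (glmLaw ν σ η) := by
    rw [integrable_glmLaw_iff] at hE0 ⊢
    simpa only [hkey] using hE0
  -- Jensen for `exp` under `P_η`, applied to `t 1_A - Z`; taking logarithms gives the claim.
  have hJ := convexOn_exp.map_integral_le Real.continuous_exp.continuousOn isClosed_univ
    (Filter.Eventually.of_forall fun _ => Set.mem_univ _) hgi hei
  have hexp : ∫ y, Real.exp (A.indicator (fun _ => t) y - Z y) ∂(glmLaw ν σ η) =
      1 + (Real.exp t - 1) * (glmLaw ν σ 0).real A := by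
    rw [integral_glmLaw]
    simp_rw [hkey]
    rw [← integral_glmLaw, integral_add (integrable_const _) (hAi _ hP0 _), integral_indicator hA]
    simp [mul_comm]
  have hlin : ∫ y, (A.indicator (fun _ => t) y - Z y) ∂(glmLaw ν σ η) =
      t * (glmLaw ν σ η).real A - bregman (glmLoss ν σ 0) 0 η := by
    rw [integral_sub (hAi _ hP t) hZi, bregman_glmLoss_eq hσ hν hΩ hη, integral_indicator hA]
    simp [mul_comm, hZ]
  rw [hexp, hlin] at hJ
  have := Real.log_le_log (Real.exp_pos _) hJ
  rw [Real.log_exp] at this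
  linarith

/-- With `t = log M` the logarithmic term is at most `log(2 - 1/M)`, and `(2 - 1/M)⁴ ≤ M³` bounds it
by `(3/4) log M`. Adding the divergence `log M / 8` and dividing by `log M` leaves `7/8`. -/
theorem measure_le_of_bregman_le (hσ : 0 < σ) (hν : ν ≠ 0) (hΩ : IsOpen (naturalSpace ν σ))
    (hη : η ∈ naturalSpace ν σ) (h0 : (0 : Matrix (Fin n) (Fin m) ℝ) ∈ naturalSpace ν σ)
    {A : Set (Matrix (Fin n) (Fin m) ℝ)} (hA : MeasurableSet A) {M : ℕ} (hM : 2 ≤ M)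
    (hAM : (glmLaw ν σ 0).real A ≤ 1 / M)
    (hK : bregman (glmLoss ν σ 0) 0 η ≤ Real.log M / 8) :
    (glmLaw ν σ η).real A ≤ 7 / 8 := by
  have h := log_mul_measure_le hσ hν hΩ hη h0 hA (Real.log M)
  have hM2 : (2 : ℝ) ≤ M := by exact_mod_cast hM
  have hM0 : (0 : ℝ) < M := by linarith
  have hlog : 0 < Real.log M := Real.log_pos (by linarith)
  rw [Real.exp_log hM0] at h
  have hnn : 0 ≤ (glmLaw ν σ 0).real A := measureReal_nonneg
  have h1 : 1 + ((M : ℝ) - 1) * (glmLaw ν σ 0).real A ≤ 2 - 1 / M := by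
    have := mul_le_mul_of_nonneg_left hAM (by linarith : (0 : ℝ) ≤ M - 1)
    have h2 : ((M : ℝ) - 1) * (1 / M) = 1 - 1 / M := by field_simp
    linarith
  have h2 : Real.log (1 + ((M : ℝ) - 1) * (glmLaw ν σ 0).real A) ≤ 3 / 4 * Real.log M := by
    have hpos : 0 < 1 + ((M : ℝ) - 1) * (glmLaw ν σ 0).real A := by
      have : 0 ≤ ((M : ℝ) - 1) * (glmLaw ν σ 0).real A := mul_nonneg (by linarith) hnn
      linarith
    have h3 : (1 + ((M : ℝ) - 1) * (glmLaw ν σ 0).real A) ^ 4 ≤ (M : ℝ) ^ 3 := by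
      refine (pow_le_pow_left₀ hpos.le h1 4).trans ?_
      rcases hM.eq_or_lt with rfl | h3
      · norm_num
      · have h3' : (3 : ℝ) ≤ M := by exact_mod_cast h3
        have h4 : 0 ≤ 2 - 1 / (M : ℝ) := hpos.le.trans h1
        have h5 : 2 - 1 / (M : ℝ) ≤ 2 := by
          have : 0 < 1 / (M : ℝ) := by positivity
          linarith
        calc (2 - 1 / (M : ℝ)) ^ 4 ≤ 2 ^ 4 := pow_le_pow_left₀ h4 h5 4
          _ ≤ 3 ^ 3 := by norm_num
          _ ≤ (M : ℝ) ^ 3 := pow_le_pow_left₀ (by norm_num) h3' 3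
    have h6 := Real.log_le_log (by positivity) h3
    rw [Real.log_pow, Real.log_pow] at h6
    push_cast at h6
    linarith
  by_contra hcon
  push Not at hcon
  have := mul_lt_mul_of_pos_left hcon hlog
  linarith

end ExponentialFamilyLaw

/-! ### From separated hypotheses to a minimax lower bound -/

section MinimaxReduction

theorem measurable_entry (i : Fin n) (j : Fin m) :
    Measurable fun A : Matrix (Fin n) (Fin m) ℝ => A i j :=
  (measurable_pi_apply j).comp (measurable_pi_apply i : Measurable fun A : EntrySpace n m => A i)

theorem measurable_matrix {α : Type*} [MeasurableSpace α] {f : α → Matrix (Fin n) (Fin m) ℝ}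
    (hf : ∀ i j, Measurable fun a => f a i j) : Measurable f :=
  measurable_pi_lambda (fun a => (f a : EntrySpace n m)) fun i =>
    measurable_pi_lambda (fun a => f a i) fun j => hf i j

theorem measurable_frobSq : Measurable (frobSq : Matrix (Fin n) (Fin m) ℝ → ℝ) := by
  unfold frobSq
  exact Finset.measurable_fun_sum _ fun i _ => Finset.measurable_fun_sum _ fun j _ =>
    (measurable_entry i j).pow_const 2

theorem measurable_const_sub (C : Matrix (Fin n) (Fin m) ℝ) :
    Measurable fun A : Matrix (Fin n) (Fin m) ℝ => C - A :=
  measurable_matrix fun i j => (measurable_entry i j).const_sub (C i j)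

theorem measurable_const_mul_matrix (X : Matrix (Fin n) (Fin p) ℝ) :
    Measurable fun A : Matrix (Fin p) (Fin m) ℝ => X * A :=
  measurable_matrix fun i j => by
    simp only [Matrix.mul_apply]
    exact Finset.measurable_fun_sum _ fun k _ => (measurable_entry k j).const_mul (X i k)

theorem frobSq_sub_le (A B C : Matrix (Fin n) (Fin m) ℝ) :
    frobSq (A - B) ≤ 2 * frobSq (A - C) + 2 * frobSq (B - C) := by
  simp only [frobSq, Finset.mul_sum, ← Finset.sum_add_distrib, Matrix.sub_apply]
  refine Finset.sum_le_sum fun i _ => Finset.sum_le_sum fun j _ => ?_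
  nlinarith [sq_nonneg (A i j + B i j - 2 * C i j)]

variable {q r : ℕ} {σ : ℝ} {ν : Measure (Matrix (Fin n) (Fin m) ℝ)} {X : Matrix (Fin n) (Fin p) ℝ}

theorem zero_mem_signalClass (hq : 1 ≤ q) :
    (0 : Matrix (Fin p) (Fin m) ℝ) ∈ signalClass p m q r := by
  refine ⟨?_, by simp⟩
  refine le_trans ?_ hq
  refine (Set.ncard_le_ncard (t := {(0 : Fin m → ℝ)}) ?_ (Set.finite_singleton _)).trans
    (Set.ncard_singleton _).le
  rintro _ ⟨i, rfl⟩
  rfl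

/-- Minimax lower bound from a finite family of signals that is separated in the loss and close to
`0` in Kullback-Leibler divergence. -/
theorem le_minimaxRisk_of_separated (hmod : IsModel q r σ ν X) {ι : Type*} [Fintype ι]
    (hcard : 2 ≤ Fintype.card ι) (B : ι → Matrix (Fin p) (Fin m) ℝ)
    (hB : ∀ i, B i ∈ signalClass p m q r)
    (hK : ∀ i, bregman (glmLoss ν σ 0) 0 (X * B i) ≤ Real.log (Fintype.card ι) / 8)
    {k : ℕ} (G : Matrix (Fin p) (Fin m) ℝ → Matrix (Fin k) (Fin m) ℝ) (hG : Measurable G)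
    {s : ℝ} (hs : ∀ i j, i ≠ j → s ≤ frobSq (G (B i) - G (B j)))
    {I : ℝ → ℝ} (hI : MonotoneOn I (Set.Ici 0)) {t ρ : ℝ} (ht : 0 ≤ t) (hIt : 0 ≤ I t)
    (hρ : 0 < ρ) (htρ : t * ρ ≤ s / 4) :
    ENNReal.ofReal (I t / 8) ≤
      minimaxRisk q r σ ν X fun B B' => I (frobSq (G B - G B') / ρ) := by
  classical
  have hσ := hmod.σ_pos
  have hν := hmod.ν_ne_zero
  have h0 : (0 : Matrix (Fin n) (Fin m) ℝ) ∈ naturalSpace ν σ := by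
    have := hmod.mem_naturalSpace 0
      (zero_mem_signalClass (by have := hmod.two_le_r; have := hmod.r_le_q; omega))
    rwa [Matrix.mul_zero] at this
  have hP0 := isProbabilityMeasure_glmLaw hσ hν h0
  refine le_iInf₂ fun Bhat hBhat => ?_
  set A : ι → Set (Matrix (Fin n) (Fin m) ℝ) :=
    fun i => {Y | frobSq (G (B i) - G (Bhat Y)) < s / 4} with hAdef
  have hA : ∀ i, MeasurableSet (A i) := fun i =>
    measurableSet_lt (measurable_frobSq.comp ((measurable_const_sub _).comp (hG.comp hBhat)))
      measurable_const
  -- An estimate within squared distance `s / 4` of two signals would put them at squared distance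
  -- below `2 (s/4) + 2 (s/4) = s`.
  have hdisj : Pairwise (Function.onFun Disjoint A) := by
    intro i j hij
    refine Set.disjoint_left.2 fun Y hi hj => ?_
    simp only [hAdef, Set.mem_ofPred_eq] at hi hj
    have h1 := frobSq_sub_le (G (B i)) (G (B j)) (G (Bhat Y))
    have h2 := hs i j hij
    linarith
  have hM0 : (0 : ℝ) < Fintype.card ι := by
    have : 0 < Fintype.card ι := by omega
    exact_mod_cast this
  -- Pigeonhole: the `P_0`-probabilities of the disjoint events sum to at most `1`.
  obtain ⟨j, -, hj⟩ : ∃ j ∈ Finset.univ, (glmLaw ν σ 0).real (A j) ≤ 1 / Fintype.card ι := by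
    refine Finset.exists_le_of_sum_le ?_ ?_
    · exact Finset.univ_nonempty_iff.2 (Fintype.card_pos_iff.1 (by omega))
    · rw [Finset.sum_const, Finset.card_univ, nsmul_eq_mul, mul_one_div_cancel hM0.ne',
        ← measureReal_biUnion_finset (fun i _ j _ hij => hdisj hij) fun i _ => hA i]
      exact measureReal_le_one
  have hη := hmod.mem_naturalSpace (B j) (hB j)
  have hP := isProbabilityMeasure_glmLaw hσ hν hη
  have hAj := measure_le_of_bregman_le hσ hν hmod.regular hη h0 (hA j) hcard hj (hK j)
  refine le_iSup₂_of_le (B j) (hB j) ?_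
  have hcompl : 1 / 8 ≤ (glmLaw ν σ (X * B j)).real (A j)ᶜ := by
    rw [probReal_compl_eq_one_sub (hA j)]
    linarith
  calc ENNReal.ofReal (I t / 8)
      ≤ ENNReal.ofReal (I t * (glmLaw ν σ (X * B j)).real (A j)ᶜ) := by
        refine ENNReal.ofReal_le_ofReal ?_
        rw [div_eq_mul_one_div]
        exact mul_le_mul_of_nonneg_left hcompl hIt
    _ = ENNReal.ofReal (I t) * glmLaw ν σ (X * B j) (A j)ᶜ := by
        rw [ENNReal.ofReal_mul hIt, ofReal_measureReal]
    _ = ∫⁻ _ in (A j)ᶜ, ENNReal.ofReal (I t) ∂(glmLaw ν σ (X * B j)) := by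
        rw [setLIntegral_const]
    _ ≤ ∫⁻ Y in (A j)ᶜ, ENNReal.ofReal (I (frobSq (G (B j) - G (Bhat Y)) / ρ))
          ∂(glmLaw ν σ (X * B j)) := by
        refine setLIntegral_mono' (hA j).compl fun Y hY => ENNReal.ofReal_le_ofReal ?_
        simp only [hAdef, Set.mem_compl_iff, Set.mem_ofPred_eq, not_lt] at hY
        have hle : t ≤ frobSq (G (B j) - G (Bhat Y)) / ρ := by
          rw [le_div_iff₀ hρ]
          linarith
        exact hI ht (ht.trans hle) hle
    _ ≤ _ := setLIntegral_le_lintegral _ _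

end MinimaxReduction

/-! ### A Gilbert-Varshamov bound over a general alphabet -/

section HammingPacking

variable {ι : Type*} [Fintype ι] [DecidableEq ι] {Q : ℕ}

/-- The distance generating function factorizes over coordinates, each contributing one agreeing
letter and `Q - 1` others. -/
theorem sum_pow_hammingDist (x : ι → Fin Q) (t : ℝ) :
    ∑ w : ι → Fin Q, t ^ hammingDist w x = (1 + (Q - 1) * t) ^ Fintype.card ι := by
  have h1 : ∀ w : ι → Fin Q, t ^ hammingDist w x = ∏ i, if w i = x i then 1 else t := by
    intro w
    rw [hammingDist, Finset.prod_ite, Finset.prod_const_one, one_mul, Finset.prod_const]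
  have h2 : ∀ i, ∑ a : Fin Q, (if a = x i then 1 else t) = 1 + (Q - 1) * t := by
    intro i
    have h3 : ∀ a : Fin Q, (if a = x i then 1 else t) = t + if a = x i then 1 - t else 0 := by
      intro a
      split_ifs <;> ring
    simp only [h3, Finset.sum_add_distrib, Finset.sum_const, Finset.card_univ, Fintype.card_fin,
      nsmul_eq_mul, Finset.sum_ite_eq', Finset.mem_univ, if_true]
    ring
  simp_rw [h1]
  rw [← Fintype.piFinset_univ, ← Finset.prod_univ_sum (fun _ => Finset.univ)
    (fun i a => if a = x i then (1 : ℝ) else t)]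
  simp_rw [h2]
  rw [Finset.prod_const, Finset.card_univ]

/-- Chernoff's method with `t = Q⁻²`: every word of the ball has weight `t ^ d ≥ Q ^ (-N/4)`, while
the total weight is at most `(5/4) ^ N` because `(Q - 1) / Q² ≤ 1/4`. Fourth powers remove the
fractional exponent, and `(5/4)⁴ ≤ Q²`. -/
theorem card_hammingBall_pow_le (hQ : 2 ≤ Q) (x : ι → Fin Q) :
    ((Finset.univ.filter fun w : ι → Fin Q => 8 * hammingDist w x ≤ Fintype.card ι).card : ℝ) ^ 4 ≤
      (Q : ℝ) ^ (3 * Fintype.card ι) := by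
  set N := Fintype.card ι
  set V := Finset.univ.filter fun w : ι → Fin Q => 8 * hammingDist w x ≤ N
  have hQ2 : (2 : ℝ) ≤ Q := by exact_mod_cast hQ
  have hQ0 : (0 : ℝ) < Q := by linarith
  set t : ℝ := ((Q : ℝ) ^ 2)⁻¹ with ht
  have ht0 : 0 < t := by positivity
  set u : ℝ := (Q : ℝ) ^ (-(N : ℝ) / 4) with hu
  have hu0 : 0 < u := by positivity
  have hle : (V.card : ℝ) * u ≤ (5 / 4) ^ N := by
    calc (V.card : ℝ) * u = ∑ w ∈ V, u := by rw [Finset.sum_const, nsmul_eq_mul]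
      _ ≤ ∑ w ∈ V, t ^ hammingDist w x := by
          refine Finset.sum_le_sum fun w hw => ?_
          have hw' : 8 * hammingDist w x ≤ N := (Finset.mem_filter.1 hw).2
          have : t ^ hammingDist w x = (Q : ℝ) ^ (-(2 * hammingDist w x : ℝ)) := by
            rw [ht, inv_pow, ← pow_mul, Real.rpow_neg hQ0.le]
            congr 1
            exact_mod_cast (Real.rpow_natCast (Q : ℝ) (2 * hammingDist w x)).symm
          rw [this, hu]
          refine Real.rpow_le_rpow_of_exponent_le (by linarith) ?_
          have : (8 : ℝ) * hammingDist w x ≤ N := by exact_mod_cast hw'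
          linarith
      _ ≤ ∑ w : ι → Fin Q, t ^ hammingDist w x :=
          Finset.sum_le_univ_sum_of_nonneg fun w => by positivity
      _ = (1 + (Q - 1) * t) ^ N := sum_pow_hammingDist x t
      _ ≤ (5 / 4) ^ N := by
          have h1 : (Q - 1) * t ≤ 1 / 4 := by
            rw [ht, ← div_eq_mul_inv, div_le_iff₀ (by positivity)]
            nlinarith [sq_nonneg ((Q : ℝ) - 2)]
          have h2 : 0 ≤ ((Q : ℝ) - 1) * t := mul_nonneg (by linarith) ht0.le
          exact pow_le_pow_left₀ (by linarith) (by linarith) N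
  have hu4 : u ^ 4 * (Q : ℝ) ^ N = 1 := by
    rw [hu, ← Real.rpow_natCast, ← Real.rpow_mul hQ0.le, ← Real.rpow_natCast (Q : ℝ) N,
      ← Real.rpow_add hQ0]
    have : -(N : ℝ) / 4 * ((4 : ℕ) : ℝ) + N = 0 := by push_cast; ring
    rw [this, Real.rpow_zero]
  have h4 : (V.card : ℝ) ^ 4 * u ^ 4 ≤ (Q : ℝ) ^ (2 * N) := by
    rw [← mul_pow]
    calc ((V.card : ℝ) * u) ^ 4 ≤ ((5 / 4) ^ N) ^ 4 := pow_le_pow_left₀ (by positivity) hle 4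
      _ = ((5 / 4) ^ 4) ^ N := by rw [← pow_mul, ← pow_mul, mul_comm]
      _ ≤ ((Q : ℝ) ^ 2) ^ N := by
          refine pow_le_pow_left₀ (by positivity) ?_ N
          nlinarith
      _ = (Q : ℝ) ^ (2 * N) := (pow_mul _ _ _).symm
  calc (V.card : ℝ) ^ 4 = (V.card : ℝ) ^ 4 * u ^ 4 * (Q : ℝ) ^ N := by
        rw [mul_assoc, hu4, mul_one]
    _ ≤ (Q : ℝ) ^ (2 * N) * (Q : ℝ) ^ N := by gcongr
    _ = (Q : ℝ) ^ (3 * N) := by rw [← pow_add]; congr 1; ring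

/-- A Gilbert-Varshamov bound: there are at least `Q ^ (N / 4)` words of length `N` over an alphabet
with `Q` letters whose pairwise Hamming distances are at least `N / 8`. -/
theorem exists_hamming_packing (hQ : 2 ≤ Q) :
    ∃ S : Finset (ι → Fin Q),
      (∀ x ∈ S, ∀ y ∈ S, x ≠ y → Fintype.card ι ≤ 8 * hammingDist x y) ∧
      (Q : ℝ) ^ Fintype.card ι ≤ (S.card : ℝ) ^ 4 := by
  classical
  set N := Fintype.card ι
  obtain ⟨S, hS, hmax⟩ := Finset.exists_max_image
    (Finset.univ.filter fun S : Finset (ι → Fin Q) =>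
      ∀ x ∈ S, ∀ y ∈ S, x ≠ y → N ≤ 8 * hammingDist x y) Finset.card
    ⟨∅, by simp⟩
  simp only [Finset.mem_filter, Finset.mem_univ, true_and] at hS hmax
  refine ⟨S, hS, ?_⟩
  -- A code of maximal size covers: an uncovered word could be added to it.
  have hcover : ∀ w : ι → Fin Q, ∃ x ∈ S, 8 * hammingDist w x ≤ N := by
    intro w
    by_contra! hcon
    have hw : w ∉ S := fun hw => by simpa using hcon w hw
    have h1 := hmax (insert w S) fun x hx y hy hxy => by
      rcases Finset.mem_insert.1 hx with rfl | hx' <;> rcases Finset.mem_insert.1 hy with rfl | hy'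
      · exact absurd rfl hxy
      · exact (hcon y hy').le
      · rw [hammingDist_comm]
        exact (hcon x hx').le
      · exact hS x hx' y hy' hxy
    rw [Finset.card_insert_of_notMem hw] at h1
    omega
  have hQ2 : (2 : ℝ) ≤ Q := by exact_mod_cast hQ
  have hQ0 : (0 : ℝ) < Q := by linarith
  have hne : S.Nonempty := by
    have : NeZero Q := ⟨by omega⟩
    obtain ⟨x, hx, -⟩ := hcover fun _ => 0
    exact ⟨x, hx⟩
  set V : (ι → Fin Q) → Finset (ι → Fin Q) :=
    fun x => Finset.univ.filter fun w => 8 * hammingDist w x ≤ N with hV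
  obtain ⟨x, -, hx⟩ := Finset.exists_max_image S (fun x => (V x).card) hne
  have hcard : Q ^ N ≤ S.card * (V x).card := by
    calc Q ^ N = (Finset.univ : Finset (ι → Fin Q)).card := by
          rw [Finset.card_univ, Fintype.card_fun, Fintype.card_fin]
      _ ≤ (S.biUnion V).card := by
          refine Finset.card_le_card fun w _ => ?_
          obtain ⟨x, hx, hd⟩ := hcover w
          exact Finset.mem_biUnion.2 ⟨x, hx, by simp [hV, hd]⟩
      _ ≤ S.card * (V x).card := Finset.card_biUnion_le_card_mul _ _ _ hx
  have hcard' : (Q : ℝ) ^ N ≤ S.card * (V x).card := by exact_mod_cast hcard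
  have h4 : (Q : ℝ) ^ N * (Q : ℝ) ^ (3 * N) ≤ (S.card : ℝ) ^ 4 * (Q : ℝ) ^ (3 * N) := by
    calc (Q : ℝ) ^ N * (Q : ℝ) ^ (3 * N) = ((Q : ℝ) ^ N) ^ 4 := by
          rw [← pow_mul, ← pow_add]; congr 1; ring
      _ ≤ ((S.card : ℝ) * (V x).card) ^ 4 := pow_le_pow_left₀ (by positivity) hcard' 4
      _ = (S.card : ℝ) ^ 4 * ((V x).card : ℝ) ^ 4 := mul_pow _ _ _
      _ ≤ (S.card : ℝ) ^ 4 * (Q : ℝ) ^ (3 * N) := by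
          gcongr
          exact card_hammingBall_pow_le hQ x
  exact le_of_mul_le_mul_right h4 (by positivity)

theorem two_le_card_and_log_le {Q N M : ℕ} (hQ : 2 ≤ Q) (hN : 1 ≤ N)
    (h : (Q : ℝ) ^ N ≤ (M : ℝ) ^ 4) : 2 ≤ M ∧ N * Real.log Q / 4 ≤ Real.log M := by
  have hQ2 : (2 : ℝ) ≤ Q := by exact_mod_cast hQ
  have h1 : (1 : ℝ) < (Q : ℝ) ^ N := one_lt_pow₀ (by linarith) (by omega)
  constructor
  · by_contra hM
    have : (M : ℝ) ≤ 1 := by exact_mod_cast (by omega : M ≤ 1)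
    have := pow_le_one₀ (n := 4) (Nat.cast_nonneg M) this
    linarith
  · have := Real.log_le_log (by positivity) h
    rw [Real.log_pow, Real.log_pow] at this
    push_cast at this
    linarith

end HammingPacking

/-! ### Sparse integer words as a dictionary of rows -/

section SparseWords

/-- The words over `{0, …, b}` with at most `ζ` nonzero letters. -/
def sparseWords (r b ζ : ℕ) : Finset (Fin r → Fin (b + 1)) :=
  Finset.univ.filter fun v => (Finset.univ.filter fun j => v j ≠ 0).card ≤ ζ

/-- Words are sorted by their support `T`: exactly `b ^ T.card` words have support `T`. -/
theorem sum_choose_le_card_sparseWords (r b ζ : ℕ) :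
    ∑ i ∈ Finset.range (ζ + 1), r.choose i * b ^ i ≤ (sparseWords r b ζ).card := by
  classical
  set F : Finset (Fin r) → Finset (Fin r → Fin (b + 1)) := fun T =>
    Fintype.piFinset fun j => if j ∈ T then Finset.univ.erase 0 else {0} with hF
  have hFmem : ∀ T v, v ∈ F T → (Finset.univ.filter fun j => v j ≠ 0) = T := by
    intro T v hv
    ext j
    have := Fintype.mem_piFinset.1 hv j
    by_cases hj : j ∈ T <;> simp_all
  have hFcard : ∀ T, (F T).card = b ^ T.card := by
    intro T
    rw [hF, Fintype.card_piFinset]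
    simp only [apply_ite Finset.card, Finset.card_erase_of_mem (Finset.mem_univ _),
      Finset.card_univ, Fintype.card_fin, Finset.card_singleton, Nat.add_sub_cancel]
    rw [Finset.prod_ite, Finset.prod_const, Finset.prod_const_one, mul_one, Finset.filter_mem_eq_inter,
      Finset.univ_inter]
  set U : Finset (Finset (Fin r)) :=
    (Finset.range (ζ + 1)).biUnion fun i => Finset.powersetCard i Finset.univ with hU
  have hsum : ∑ i ∈ Finset.range (ζ + 1), r.choose i * b ^ i = ∑ T ∈ U, b ^ T.card := by
    rw [hU, Finset.sum_biUnion fun i _ j _ hij =>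
      Finset.pairwise_disjoint_powersetCard _ hij]
    refine Finset.sum_congr rfl fun i _ => ?_
    rw [Finset.sum_congr rfl fun T hT => by rw [(Finset.mem_powersetCard.1 hT).2],
      Finset.sum_const, Finset.card_powersetCard, Finset.card_univ, Fintype.card_fin, smul_eq_mul]
  rw [hsum, Finset.sum_congr rfl fun T _ => (hFcard T).symm, ← Finset.card_biUnion]
  · refine Finset.card_le_card fun v hv => ?_
    obtain ⟨T, hT, hvT⟩ := Finset.mem_biUnion.1 hv
    obtain ⟨i, hi, hTi⟩ := Finset.mem_biUnion.1 hT
    rw [sparseWords, Finset.mem_filter, hFmem T v hvT, (Finset.mem_powersetCard.1 hTi).2]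
    exact ⟨Finset.mem_univ _, by have := Finset.mem_range.1 hi; omega⟩
  · intro T _ T' _ hTT
    refine Finset.disjoint_left.2 fun v hv hv' => hTT ?_
    rw [← hFmem T v hv, hFmem T' v hv']

/-- Sparse words over `{0, …, b - 1}` serve as the dictionary: sparsity keeps the norms small, and
distinct integer vectors are at distance at least `1`. -/
theorem exists_dictionary {q r b ζ : ℕ} (h : Admissible q r b ζ) :
    ∃ v : Fin q → Fin r → ℕ, Function.Injective v ∧
      ∀ k, ∑ j, ((v k j : ℕ) : ℝ) ^ 2 ≤ (b : ℝ) ^ 2 * ζ := by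
  obtain ⟨hb, -, -, hq⟩ := h
  obtain ⟨b', rfl⟩ : ∃ b', b = b' + 1 := ⟨b - 1, by omega⟩
  have hcard : Fintype.card (Fin q) ≤ Fintype.card (sparseWords r b' ζ) := by
    rw [Fintype.card_fin, Fintype.card_coe]
    exact hq.trans (sum_choose_le_card_sparseWords r b' ζ)
  obtain ⟨f⟩ := Function.Embedding.nonempty_of_card_le hcard
  refine ⟨fun k j => ((f k).1 j : ℕ), fun k k' hkk => ?_, fun k => ?_⟩
  · refine f.injective (Subtype.ext (funext fun j => Fin.ext ?_))
    exact congrFun hkk j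
  · have hk : (Finset.univ.filter fun j => (f k).1 j ≠ 0).card ≤ ζ := (Finset.mem_filter.1 (f k).2).2
    calc ∑ j, (((f k).1 j : ℕ) : ℝ) ^ 2
        = ∑ j ∈ Finset.univ.filter fun j => (f k).1 j ≠ 0, (((f k).1 j : ℕ) : ℝ) ^ 2 := by
          refine (Finset.sum_filter_of_ne fun j _ hj => ?_).symm
          intro h0
          simp [h0] at hj
      _ ≤ ∑ j ∈ Finset.univ.filter fun j => (f k).1 j ≠ 0, ((b' + 1 : ℕ) : ℝ) ^ 2 := by
          refine Finset.sum_le_sum fun j _ => ?_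
          have : (((f k).1 j : ℕ) : ℝ) ≤ ((b' + 1 : ℕ) : ℝ) := by
            exact_mod_cast ((f k).1 j).2.le
          gcongr
      _ ≤ ((b' + 1 : ℕ) : ℝ) ^ 2 * ζ := by
          rw [Finset.sum_const, nsmul_eq_mul, mul_comm]
          gcongr

end SparseWords

/-! ### Placing a block inside a larger zero matrix -/

section Embedding

variable {a k : ℕ}

/-- The matrix whose left multiplication places row `i` into position `f i`. -/
def rowEmbedding (f : Fin a → Fin k) : Matrix (Fin k) (Fin a) ℝ :=
  (1 : Matrix (Fin k) (Fin k) ℝ).submatrix id f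

theorem rowEmbedding_mul_apply {f : Fin a → Fin k} (hf : Function.Injective f)
    (P : Matrix (Fin a) (Fin m) ℝ) (i : Fin a) (j : Fin m) :
    (rowEmbedding f * P) (f i) j = P i j := by
  simp [rowEmbedding, Matrix.mul_apply, Matrix.one_apply, hf.eq_iff]

theorem rowEmbedding_mul_apply_of_notMem {f : Fin a → Fin k}
    (P : Matrix (Fin a) (Fin m) ℝ) {i : Fin k} (hi : i ∉ Set.range f) (j : Fin m) :
    (rowEmbedding f * P) i j = 0 := by
  rw [Matrix.mul_apply]
  refine Finset.sum_eq_zero fun x _ => ?_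
  have : i ≠ f x := fun h => hi ⟨x, h.symm⟩
  simp [rowEmbedding, this]

theorem frobSq_rowEmbedding_mul {f : Fin a → Fin k} (hf : Function.Injective f)
    (P : Matrix (Fin a) (Fin m) ℝ) : frobSq (rowEmbedding f * P) = frobSq P := by
  refine (Fintype.sum_of_injective f hf _ _ (fun i hi => ?_) fun i => ?_).symm
  · exact Finset.sum_eq_zero fun j _ => by rw [rowEmbedding_mul_apply_of_notMem P hi]; norm_num
  · exact Finset.sum_congr rfl fun j _ => by rw [rowEmbedding_mul_apply hf]

theorem frobSq_transpose (P : Matrix (Fin n) (Fin m) ℝ) : frobSq P.transpose = frobSq P :=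
  Finset.sum_comm

theorem frobSq_smul (c : ℝ) (P : Matrix (Fin n) (Fin m) ℝ) :
    frobSq (c • P) = c ^ 2 * frobSq P := by
  simp only [frobSq, Finset.mul_sum, Matrix.smul_apply, smul_eq_mul, mul_pow]

theorem frobSq_mul_rowEmbedding_transpose {f : Fin a → Fin k} (hf : Function.Injective f)
    (P : Matrix (Fin n) (Fin a) ℝ) : frobSq (P * (rowEmbedding f).transpose) = frobSq P := by
  rw [← frobSq_transpose, Matrix.transpose_mul, Matrix.transpose_transpose,
    frobSq_rowEmbedding_mul hf, frobSq_transpose]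

theorem numDistinctRows_rowEmbedding_mul_le {f : Fin a → Fin k} (hf : Function.Injective f)
    (P : Matrix (Fin a) (Fin m) ℝ) : numDistinctRows (rowEmbedding f * P) ≤ a + 1 := by
  have hsub : (Set.range fun i => (rowEmbedding f * P).row i) ⊆
      insert 0 (Set.range fun i => P.row i) := by
    rintro _ ⟨i, rfl⟩
    by_cases hi : i ∈ Set.range f
    · obtain ⟨x, rfl⟩ := hi
      exact Or.inr ⟨x, funext fun j => (rowEmbedding_mul_apply hf P x j).symm⟩
    · exact Or.inl (funext fun j => rowEmbedding_mul_apply_of_notMem P hi j)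
  refine (Set.ncard_le_ncard hsub ((Set.finite_range _).insert _)).trans
    ((Set.ncard_insert_le _ _).trans (Nat.add_le_add_right ?_ 1))
  rw [← Set.image_univ]
  refine (Set.ncard_image_le Set.finite_univ).trans ?_
  rw [Set.ncard_univ, Nat.card_eq_fintype_card, Fintype.card_fin]

theorem numDistinctRows_mul_le (P : Matrix (Fin k) (Fin a) ℝ) (R : Matrix (Fin a) (Fin m) ℝ) :
    numDistinctRows (P * R) ≤ numDistinctRows P := by
  have : (Set.range fun i => (P * R).row i) =
      (fun u => Matrix.vecMul u R) '' Set.range fun i => P.row i := by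
    rw [← Set.range_comp]
    rfl
  rw [numDistinctRows, this]
  exact Set.ncard_image_le (Set.finite_range _)

end Embedding

/-! ### Packings of the signal class -/

section Packing

variable {k : ℕ}

/-- A class of matrices has packings of complexity `τ` at every scale `a`: finite families of
`M ≥ 2` members with squared norms at most `a log M` and squared distances at least `a τ`. -/
def HasPacking (S : Set (Matrix (Fin k) (Fin m) ℝ)) (τ : ℝ) : Prop :=
  ∀ a : ℝ, 0 < a → ∃ (ι : Type) (_ : Fintype ι) (C : ι → Matrix (Fin k) (Fin m) ℝ),
    2 ≤ Fintype.card ι ∧ (∀ i, C i ∈ S) ∧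
    (∀ i, frobSq (C i) ≤ a * Real.log (Fintype.card ι)) ∧
    ∀ i j, i ≠ j → a * τ ≤ frobSq (C i - C j)

theorem HasPacking.mono {S S' : Set (Matrix (Fin k) (Fin m) ℝ)} {τ τ' : ℝ} (h : HasPacking S τ)
    (hS : S ⊆ S') (hτ : τ' ≤ τ) : HasPacking S' τ' := by
  intro a ha
  obtain ⟨ι, _, C, h2, hC, hn, hs⟩ := h a ha
  exact ⟨ι, _, C, h2, fun i => hS (hC i), hn, fun i j hij =>
    (mul_le_mul_of_nonneg_left hτ ha.le).trans (hs i j hij)⟩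

/-- Matrices built from codewords have packings of complexity proportional to the code length. -/
theorem hasPacking_of_words {κ : Type} [Fintype κ] [DecidableEq κ] [Nonempty κ] {Q : ℕ}
    (hQ : 2 ≤ Q) (P : (κ → Fin Q) → Matrix (Fin k) (Fin m) ℝ) {S : Set (Matrix (Fin k) (Fin m) ℝ)}
    (hPS : ∀ (c : ℝ) w, c • P w ∈ S) {h : ℝ} (hh : 0 < h)
    (hn : ∀ w, frobSq (P w) ≤ Fintype.card κ * h)
    (hd : ∀ w w', (hammingDist w w' : ℝ) ≤ frobSq (P w - P w')) :
    HasPacking S (Fintype.card κ * Real.log Q / (32 * h)) := by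
  intro a ha
  obtain ⟨W, hW, hcard⟩ := exists_hamming_packing (ι := κ) hQ
  obtain ⟨h2, hlog⟩ := two_le_card_and_log_le hQ (Nat.succ_le_of_lt Fintype.card_pos) hcard
  have hQ2 : (2 : ℝ) ≤ Q := by exact_mod_cast hQ
  have hlQ : 0 ≤ Real.log Q := Real.log_nonneg (by linarith)
  -- The largest scaling for which the norm bound `θ N h` equals `a N log Q / 4`, a lower bound for
  -- `a log M`.
  set θ : ℝ := a * Real.log Q / (4 * h) with hθ
  have hθ0 : 0 ≤ θ := by positivity
  refine ⟨W, inferInstance, fun w => Real.sqrt θ • P w, ?_, fun w => hPS _ _, fun w => ?_,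
    fun w w' hww => ?_⟩
  · rwa [Fintype.card_coe]
  · rw [frobSq_smul, Real.sq_sqrt hθ0, Fintype.card_coe]
    calc θ * frobSq (P w) ≤ θ * (Fintype.card κ * h) := by gcongr; exact hn w
      _ = a * (Fintype.card κ * Real.log Q / 4) := by rw [hθ]; field_simp
      _ ≤ a * Real.log W.card := by gcongr
  · rw [← smul_sub, frobSq_smul, Real.sq_sqrt hθ0]
    have h8 : (Fintype.card κ : ℝ) ≤ 8 * hammingDist w.1 w'.1 := by
      exact_mod_cast hW w.1 w.2 w'.1 w'.2 fun h => hww (Subtype.ext h)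
    calc a * (Fintype.card κ * Real.log Q / (32 * h)) = θ * (Fintype.card κ / 8) := by
          rw [hθ]; field_simp; ring
      _ ≤ θ * frobSq (P w - P w') := by
          have := hd w.1 w'.1
          gcongr
          linarith

theorem one_le_sq_sub_of_ne {x y : ℕ} (h : x ≠ y) : (1 : ℝ) ≤ ((x : ℝ) - y) ^ 2 := by
  have : (1 : ℤ) ≤ ((x : ℤ) - y) ^ 2 := by
    have h' : (x : ℤ) - y ≠ 0 := by omega
    exact Int.add_one_le_iff.2 ((sq_nonneg _).lt_of_ne' (pow_ne_zero 2 h'))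
  exact_mod_cast this

/-- A `0/1` block of size `a × b` is padded by zeros; the extra distinct row is the zero row. The
constant uses `log 2 ≥ 1/2`. -/
theorem hasPacking_block {a b : ℕ} (ha : 1 ≤ a) (hb : 1 ≤ b) (hak : a ≤ k) (hbm : b ≤ m) :
    HasPacking {C : Matrix (Fin k) (Fin m) ℝ |
      numDistinctRows C ≤ a + 1 ∧ C.rank ≤ a ∧ C.rank ≤ b} (a * b / 64) := by
  have : Nonempty (Fin a × Fin b) := ⟨⟨0, ha⟩, ⟨0, hb⟩⟩
  set f : Fin a → Fin k := Fin.castLE hak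
  set g : Fin b → Fin m := Fin.castLE hbm
  have hf : Function.Injective f := Fin.castLE_injective hak
  have hg : Function.Injective g := Fin.castLE_injective hbm
  set W : (Fin a × Fin b → Fin 2) → Matrix (Fin a) (Fin b) ℝ :=
    fun w => Matrix.of fun i j => ((w (i, j) : ℕ) : ℝ) with hW
  set P : (Fin a × Fin b → Fin 2) → Matrix (Fin k) (Fin m) ℝ :=
    fun w => rowEmbedding f * W w * (rowEmbedding g).transpose with hP
  have hfrob : ∀ A : Matrix (Fin a) (Fin b) ℝ,
      frobSq (rowEmbedding f * A * (rowEmbedding g).transpose) = frobSq A := fun A => by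
    rw [frobSq_mul_rowEmbedding_transpose hg, frobSq_rowEmbedding_mul hf]
  have hcard : Fintype.card (Fin a × Fin b) = a * b := by simp
  have hpack : HasPacking {C : Matrix (Fin k) (Fin m) ℝ |
      numDistinctRows C ≤ a + 1 ∧ C.rank ≤ a ∧ C.rank ≤ b}
      (Fintype.card (Fin a × Fin b) * Real.log (2 : ℕ) / (32 * 1)) := by
    refine hasPacking_of_words le_rfl P (fun c w => ?_) one_pos (fun w => ?_) fun w w' => ?_
    · have h1 : c • P w = rowEmbedding f * (c • W w * (rowEmbedding g).transpose) := by
        simp only [hP, Matrix.mul_assoc, Matrix.smul_mul, Matrix.mul_smul]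
      rw [h1]
      refine ⟨numDistinctRows_rowEmbedding_mul_le hf _, ?_, ?_⟩
      · exact (Matrix.rank_mul_le_left _ _).trans (Matrix.rank_le_width _)
      · exact (Matrix.rank_mul_le_right _ _).trans
          ((Matrix.rank_mul_le_left _ _).trans (Matrix.rank_le_width _))
    · rw [hP, hfrob, mul_one, frobSq, ← Fintype.sum_prod_type', ← Finset.card_univ,
        ← nsmul_one, ← Finset.sum_const]
      refine Finset.sum_le_sum fun x _ => ?_
      have h1 : ((w x : ℕ) : ℝ) ≤ 1 := by exact_mod_cast Nat.le_of_lt_succ (w x).2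
      exact pow_le_one₀ (Nat.cast_nonneg _) h1
    · have : P w - P w' = rowEmbedding f * (W w - W w') * (rowEmbedding g).transpose := by
        rw [hP, Matrix.mul_sub, Matrix.sub_mul]
      rw [this, hfrob, frobSq, ← Fintype.sum_prod_type', hammingDist, Finset.cast_card,
        Finset.sum_filter]
      refine Finset.sum_le_sum fun x _ => ?_
      split_ifs with hx
      · exact one_le_sq_sub_of_ne fun h => hx (Fin.ext h)
      · positivity
  refine hpack.mono le_rfl ?_
  rw [hcard]
  push_cast
  have := Real.log_two_gt_d9
  have h0 : (0 : ℝ) ≤ a * b := by positivity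
  nlinarith

/-- The codeword assigns each of the `p` rows to one of `q` dictionary rows, so a change of one
letter moves the matrix by at least `1` in squared norm. -/
theorem hasPacking_clusters {q r b ζ : ℕ} (hq : 2 ≤ q) (hqp : q ≤ p) (hrm : r ≤ m)
    (hadm : Admissible q r b ζ) :
    HasPacking (signalClass p m q r) (p * Real.log q / (32 * ((b : ℝ) ^ 2 * ζ))) := by
  obtain ⟨v, hv, hvn⟩ := exists_dictionary hadm
  have : Nonempty (Fin p) := ⟨⟨0, by omega⟩⟩
  set g : Fin r → Fin m := Fin.castLE hrm
  have hg : Function.Injective g := Fin.castLE_injective hrm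
  set W : (Fin p → Fin q) → Matrix (Fin p) (Fin r) ℝ :=
    fun w => Matrix.of fun i j => ((v (w i) j : ℕ) : ℝ) with hW
  set P : (Fin p → Fin q) → Matrix (Fin p) (Fin m) ℝ :=
    fun w => W w * (rowEmbedding g).transpose with hP
  have hpos : 0 < (b : ℝ) ^ 2 * ζ := by
    have h1 : (0 : ℝ) < b := by exact_mod_cast (by have := hadm.1; omega : 0 < b)
    have h2 : (0 : ℝ) < ζ := by exact_mod_cast (by have := hadm.2.1; omega : 0 < ζ)
    positivity
  have hcard : (Fintype.card (Fin p) : ℝ) = p := by simp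
  rw [← hcard]
  refine hasPacking_of_words hq P (fun c w => ?_) hpos (fun w => ?_) fun w w' => ?_
  · have h1 : c • P w = (c • W w) * (rowEmbedding g).transpose := by
      rw [hP, Matrix.smul_mul]
    rw [h1]
    refine ⟨(numDistinctRows_mul_le _ _).trans ?_,
      (Matrix.rank_mul_le_left _ _).trans (Matrix.rank_le_width _)⟩
    have hsub : (Set.range fun i => (c • W w).row i) ⊆
        (fun l : Fin q => c • fun j => ((v l j : ℕ) : ℝ)) '' Set.univ := by
      rintro _ ⟨i, rfl⟩
      exact ⟨w i, trivial, rfl⟩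
    refine (Set.ncard_le_ncard hsub (Set.toFinite _)).trans
      ((Set.ncard_image_le Set.finite_univ).trans ?_)
    rw [Set.ncard_univ, Nat.card_eq_fintype_card, Fintype.card_fin]
  · rw [hP, frobSq_mul_rowEmbedding_transpose hg, frobSq, ← Finset.card_univ, ← nsmul_eq_mul,
      ← Finset.sum_const]
    exact Finset.sum_le_sum fun i _ => hvn (w i)
  · have : P w - P w' = (W w - W w') * (rowEmbedding g).transpose := by
      rw [hP, Matrix.sub_mul]
    rw [this, frobSq_mul_rowEmbedding_transpose hg, frobSq, hammingDist, Finset.cast_card,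
      Finset.sum_filter]
    refine Finset.sum_le_sum fun i _ => ?_
    split_ifs with hi
    · obtain ⟨j, hj⟩ : ∃ j, v (w i) j ≠ v (w' i) j := by
        by_contra! hcon
        exact hi (hv (funext hcon))
      exact (one_le_sq_sub_of_ne hj).trans
        (Finset.single_le_sum (f := fun j => ((W w - W w') i j) ^ 2) (fun _ _ => sq_nonneg _)
          (Finset.mem_univ j))
    · exact Finset.sum_nonneg fun _ _ => sq_nonneg _

/-- The largest of the three summands of the rate is at least a third of it, whence `384 = 3 · 128`.
The blocks have `q - 1` and `r - 1` rows to leave room for the zero row; this costs a factor of at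
most `2`. -/
theorem hasPacking_signalClass {q r b ζ : ℕ} (hr : 2 ≤ r) (hrq : r ≤ q) (hqp : q ≤ p) (hrm : r ≤ m)
    (hadm : Admissible q r b ζ) :
    HasPacking (signalClass p m q r) (generalRate p m q r b ζ / 384) := by
  have hq1 : (2 : ℝ) ≤ q := by exact_mod_cast hr.trans hrq
  have hr1 : (2 : ℝ) ≤ r := by exact_mod_cast hr
  have hm0 : (0 : ℝ) ≤ m := Nat.cast_nonneg m
  have h1 : HasPacking (signalClass p m q r) (q * r / 128) := by
    refine (hasPacking_block (a := q - 1) (b := r) (by omega) (by omega) (by omega) hrm).mono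
      (fun C hC => ⟨hC.1.trans (by omega), hC.2.2⟩) ?_
    rw [Nat.cast_sub (by omega)]
    push_cast
    nlinarith
  have h2 : HasPacking (signalClass p m q r) (m * r / 128) := by
    refine (hasPacking_block (a := r - 1) (b := m) (by omega) (by omega) (by omega) le_rfl).mono
      (fun C hC => ⟨hC.1.trans (by omega), hC.2.1.trans (by omega)⟩) ?_
    rw [Nat.cast_sub (by omega)]
    push_cast
    nlinarith
  have h3 := hasPacking_clusters (p := p) (m := m) (hr.trans hrq) hqp hrm hadm
  have h3' : p * Real.log q / (32 * ((b : ℝ) ^ 2 * ζ)) =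
      p * Real.log q / ((b : ℝ) ^ 2 * ζ) / 32 := by
    rw [mul_comm (32 : ℝ), div_div]
  rw [h3'] at h3
  set T := p * Real.log q / ((b : ℝ) ^ 2 * ζ) with hT
  have hT0 : 0 ≤ T := by
    have := Real.log_nonneg (by linarith : (1 : ℝ) ≤ q)
    positivity
  have hrate : generalRate p m q r b ζ = q * r + m * r + T := by
    rw [generalRate]; ring
  rw [hrate]
  by_cases hA : (q * r + m * r + T : ℝ) / 384 ≤ q * r / 128
  · exact h1.mono le_rfl hA
  by_cases hB : (q * r + m * r + T : ℝ) / 384 ≤ m * r / 128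
  · exact h2.mono le_rfl hB
  · refine h3.mono le_rfl ?_
    push Not at hA hB
    linarith

theorem hasPacking_rank_le {r : ℕ} (hr : 1 ≤ r) (hrk : r ≤ k) (hrm : r ≤ m) :
    HasPacking {C : Matrix (Fin k) (Fin m) ℝ | C.rank ≤ r} (((k : ℝ) + m) * r / 384) := by
  have h1 : HasPacking {C : Matrix (Fin k) (Fin m) ℝ | C.rank ≤ r} (k * r / 64) :=
    (hasPacking_block (a := k) (b := r) (by omega) hr le_rfl hrm).mono
      (fun C hC => hC.2.2) le_rfl
  have h2 : HasPacking {C : Matrix (Fin k) (Fin m) ℝ | C.rank ≤ r} (r * m / 64) :=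
    (hasPacking_block (a := r) (b := m) hr (by omega) hrk le_rfl).mono
      (fun C hC => hC.2.1) le_rfl
  have hk0 : (0 : ℝ) ≤ (k : ℝ) * r := by positivity
  have hm0 : (0 : ℝ) ≤ (r : ℝ) * m := by positivity
  rcases le_total ((k : ℝ) * r) (r * m) with h | h
  · exact h2.mono le_rfl (by linarith)
  · exact h1.mono le_rfl (by linarith)

end Packing

/-! ### The choice of `b` and `ζ` that yields `P(q, r)` -/

section Complexity

/-- Induction through `C(n+1, k+1) = (n+1)/(k+1) · C(n, k)`, since `(n+1)/(k+1) ≤ n/k` for `1 ≤ k ≤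
n`. -/
theorem div_pow_le_choose {n k : ℕ} (h : k ≤ n) : ((n : ℝ) / k) ^ k ≤ n.choose k := by
  induction k generalizing n with
  | zero => simp
  | succ k ih =>
    obtain ⟨n, rfl⟩ : ∃ n', n = n' + 1 := ⟨n - 1, by omega⟩
    have hkn : k ≤ n := by omega
    have hrec : ((n + 1).choose (k + 1) : ℝ) = ((n + 1 : ℕ) : ℝ) / (k + 1 : ℕ) * n.choose k := by
      have h1 := Nat.add_one_mul_choose_eq n k
      have h2 : ((n + 1 : ℕ) : ℝ) * n.choose k = (n + 1).choose (k + 1) * (k + 1 : ℕ) := by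
        exact_mod_cast h1
      rw [div_mul_eq_mul_div, eq_div_iff (by positivity), h2]
    rw [hrec, pow_succ']
    refine mul_le_mul_of_nonneg_left (le_trans ?_ (ih hkn)) (by positivity)
    rcases Nat.eq_zero_or_pos k with rfl | hk
    · simp
    · refine pow_le_pow_left₀ (by positivity) ?_ k
      have hk' : (0 : ℝ) < k := by exact_mod_cast hk
      have hkn' : (k : ℝ) ≤ n := by exact_mod_cast hkn
      rw [div_le_div_iff₀ (by positivity) hk']
      push_cast
      nlinarith

/-- With `L = log q` and `l = log(e r / L)`, the real number `y = L / l` solves `(e r / L) ^ y = q`,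
and `ζ` is its ceiling. The hypothesis `q ≤ e ^ r` gives `l ≥ 1`, hence `y ≤ L ≤ r`. The bound `l ≤
2 L` gives `y ≥ 1/2`, so rounding up costs at most a factor `3` and `L / (100 ζ) ≥ l / 300`. -/
theorem exists_admissible_complexityP_le {q r : ℕ} (hr : 2 ≤ r) (hrq : r ≤ q) (hq : 8 ≤ q)
    (hqr : (q : ℝ) ≤ Real.exp r) (p m : ℕ) :
    ∃ b ζ, Admissible q r b ζ ∧ complexityP p m q r ≤ 300 * generalRate p m q r b ζ ∧
      0 < complexityP p m q r := by
  have hq8 : (8 : ℝ) ≤ q := by exact_mod_cast hq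
  have hr2 : (2 : ℝ) ≤ r := by exact_mod_cast hr
  have hq0 : (0 : ℝ) < q := by linarith
  have hr0 : (0 : ℝ) < r := by linarith
  have hrq' : (r : ℝ) ≤ q := by exact_mod_cast hrq
  have he := Real.exp_one_lt_d9
  set L := Real.log q with hL
  have hL1 : 1 ≤ L := (Real.le_log_iff_exp_le hq0).2 (by linarith)
  have hL0 : 0 < L := by linarith
  have hLr : L ≤ r := by
    rw [hL, ← Real.log_exp r]
    exact Real.log_le_log hq0 hqr
  set l := Real.log (Real.exp 1 * r) - Real.log L with hl
  have hl' : l = 1 + (Real.log r - Real.log L) := by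
    rw [hl, Real.log_mul (Real.exp_pos 1).ne' hr0.ne', Real.log_exp]
    ring
  have hl1 : 1 ≤ l := by
    have := Real.log_le_log hL0 hLr
    linarith
  have hl0 : 0 < l := by linarith
  have hl2 : l ≤ 2 * L := by
    have h1 : Real.log r ≤ L := Real.log_le_log hr0 hrq'
    have h2 := Real.log_nonneg hL1
    linarith
  have hexpl : Real.exp l = Real.exp 1 * r / L := by
    rw [hl, Real.exp_sub, Real.exp_log (by positivity), Real.exp_log hL0]
  set y := L / l with hy
  have hyl : y * l = L := by rw [hy]; field_simp
  have hy0 : 0 < y := by positivity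
  have hyhalf : 1 / 2 ≤ y := by
    rw [hy, le_div_iff₀ hl0]
    linarith
  have hyr : y ≤ r := by nlinarith
  set ζ := ⌈y⌉₊ with hζ
  have hζr : ζ ≤ r := Nat.ceil_le.2 hyr
  have hζ1 : 1 ≤ ζ := Nat.ceil_pos.2 hy0
  have hζ0 : (0 : ℝ) < ζ := by exact_mod_cast hζ1
  have hyζ : y ≤ ζ := Nat.le_ceil y
  have hζ3 : (ζ : ℝ) ≤ 3 * y := by
    have := Nat.ceil_lt_add_one hy0.le
    linarith
  -- `b - 1 = 9` is what `ζ ≤ 3 L` and `e ≤ 3` require for `e r / L ≤ 9 r / ζ`. The last term of the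
  -- admissibility sum then already exceeds `q` or equals it.
  refine ⟨10, ζ, ⟨by norm_num, hζ1, hζr, ?_⟩, ?_, ?_⟩
  · have hterm : (q : ℝ) ≤ r.choose ζ * 9 ^ ζ := by
      calc (q : ℝ) = Real.exp (y * l) := by rw [hyl, hL, Real.exp_log hq0]
        _ ≤ Real.exp (ζ * l) := Real.exp_le_exp.2 (by gcongr)
        _ = (Real.exp l) ^ ζ := Real.exp_nat_mul l ζ
        _ ≤ ((r : ℝ) / ζ * 9) ^ ζ := by
            refine pow_le_pow_left₀ (Real.exp_pos _).le ?_ ζ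
            rw [hexpl, div_mul_eq_mul_div, div_le_div_iff₀ hL0 hζ0]
            have h1 : (ζ : ℝ) ≤ 3 * L := by
              refine hζ3.trans ?_
              have : y ≤ L := by nlinarith
              linarith
            calc Real.exp 1 * r * ζ ≤ 3 * r * (3 * L) := by
                  gcongr
                  linarith
              _ = r * 9 * L := by ring
        _ = ((r : ℝ) / ζ) ^ ζ * 9 ^ ζ := mul_pow _ _ _
        _ ≤ r.choose ζ * 9 ^ ζ := by
            gcongr
            exact div_pow_le_choose hζr
    have hnat : q ≤ r.choose ζ * (10 - 1) ^ ζ := by exact_mod_cast hterm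
    exact hnat.trans (Finset.single_le_sum (f := fun i => r.choose i * (10 - 1) ^ i)
      (fun _ _ => Nat.zero_le _) (Finset.self_mem_range_succ ζ))
  · have h1 : l ≤ 300 * (L / (((10 : ℕ) : ℝ) ^ 2 * ζ)) := by
      rw [← mul_div_assoc, le_div_iff₀ (by positivity)]
      push_cast
      nlinarith
    have h2 : (0 : ℝ) ≤ ((q : ℝ) + m) * r := by positivity
    have h3 := mul_le_mul_of_nonneg_left h1 (Nat.cast_nonneg p : (0 : ℝ) ≤ p)
    rw [complexityP, generalRate, mul_div_assoc]
    linarith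
  · rw [complexityP]
    have h2 : (0 : ℝ) < ((q : ℝ) + m) * r := by positivity
    have h3 : (0 : ℝ) ≤ p * l := by positivity
    linarith

theorem generalRate_pos {q r : ℕ} (hr : 2 ≤ r) (hrq : r ≤ q) (p m b ζ : ℕ) :
    0 < generalRate p m q r b ζ := by
  have hr0 : (0 : ℝ) < r := by exact_mod_cast (by omega : 0 < r)
  have hq1 : (1 : ℝ) ≤ q := by exact_mod_cast (by omega : 1 ≤ q)
  have hq0 : (0 : ℝ) < q := by linarith
  have hlog := Real.log_nonneg hq1
  have h1 : (0 : ℝ) < ((q : ℝ) + m) * r := by positivity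
  have h2 : 0 ≤ p * Real.log q / ((b : ℝ) ^ 2 * ζ) := by positivity
  rw [generalRate]
  linarith

end Complexity

/-! ### Realizing the compact decomposition by few nonzero rows -/

section RightInverse

/-- A matrix with orthonormal columns has a right inverse of its transpose that is supported on as
many rows as there are columns. -/
theorem exists_rowEmbedding_mul_eq_one {k : ℕ} {V : Matrix (Fin p) (Fin k) ℝ}
    (hV : V.transpose * V = 1) :
    ∃ (f : Fin k → Fin p) (R : Matrix (Fin k) (Fin k) ℝ), Function.Injective f ∧
      V.transpose * (rowEmbedding f * R) = 1 := by
  obtain ⟨κ, g, hg, hspan, hli⟩ := exists_linearIndependent' ℝ V.row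
  have hrank : V.rank = k := by
    refine le_antisymm (Matrix.rank_le_width V) ?_
    have h1 := Matrix.rank_mul_le_right V.transpose V
    rwa [hV, Matrix.rank_one, Fintype.card_fin] at h1
  have : Finite κ := Finite.of_injective g hg
  have := Fintype.ofFinite κ
  have hcard : Fintype.card κ = k := by
    rw [← finrank_span_eq_card hli, hspan, ← Matrix.rank_eq_finrank_span_row, hrank]
  set e : Fin k ≃ κ := (Fintype.equivFinOfCardEq hcard).symm
  -- The positions of `k` linearly independent rows of `V`; they form an invertible square block
  -- whose inverse transpose is the sought `R`.
  set f : Fin k → Fin p := g ∘ e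
  have hli' : LinearIndependent ℝ (V.submatrix f id).row := hli.comp e e.injective
  have hunit := Matrix.linearIndependent_rows_iff_isUnit.1 hli'
  have hunit' : IsUnit (V.submatrix f id).transpose.det := by
    rw [Matrix.det_transpose]
    exact (Matrix.isUnit_iff_isUnit_det _).1 hunit
  refine ⟨f, (V.submatrix f id).transpose⁻¹, hg.comp e.injective, ?_⟩
  have hsub : V.transpose * rowEmbedding f = (V.submatrix f id).transpose := by
    ext i j
    simp [rowEmbedding, Matrix.mul_apply, Matrix.one_apply]
  rw [← Matrix.mul_assoc, hsub, Matrix.mul_nonsing_inv _ hunit']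

end RightInverse

/-! ### Minimax bounds from packings -/

section MinimaxBounds

variable {q r : ℕ} {σ : ℝ} {ν : Measure (Matrix (Fin n) (Fin m) ℝ)} {X : Matrix (Fin n) (Fin p) ℝ}

theorem IsLossFunction.exists_pos {I : ℝ → ℝ} (hI : IsLossFunction I) : ∃ t, 0 < t ∧ 0 < I t := by
  obtain ⟨t, ht, hne⟩ := hI.nontrivial
  have ht0 : t ≠ 0 := fun h => hne (h ▸ hI.zero)
  refine ⟨t, ht.lt_of_ne' ht0, lt_of_le_of_ne ?_ hne.symm⟩
  rw [← hI.zero]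
  exact hI.mono (Set.mem_Ici.2 le_rfl) ht ht

/-- The minimax bound obtained from packings of a class `S` of matrices that is transferred to the
signal class by a map `J`. -/
theorem le_minimaxRisk_of_hasPacking (hmod : IsModel q r σ ν X) {k l : ℕ}
    {S : Set (Matrix (Fin k) (Fin m) ℝ)} {τ : ℝ} (hpack : HasPacking S τ)
    (J : Matrix (Fin k) (Fin m) ℝ → Matrix (Fin p) (Fin m) ℝ)
    (hJ : ∀ C ∈ S, J C ∈ signalClass p m q r) {Z : Matrix (Fin n) (Fin k) ℝ}
    (hZ : ∀ C, X * J C = Z * C) {κ : ℝ} (hκ : 0 < κ) (hcurv : CurvatureBound σ ν Z S κ)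
    (G : Matrix (Fin p) (Fin m) ℝ → Matrix (Fin l) (Fin m) ℝ) (hG : Measurable G)
    {μ : ℝ} (hμ : 0 < μ)
    (hsep : ∀ C ∈ S, ∀ C' ∈ S, μ * frobSq (C - C') ≤ frobSq (G (J C) - G (J C')))
    {I : ℝ → ℝ} (hI : MonotoneOn I (Set.Ici 0)) {t ρ : ℝ} (ht : 0 ≤ t) (hIt : 0 ≤ I t)
    (hρ : 0 < ρ) (htρ : t * ρ ≤ μ * σ ^ 2 * τ / (16 * κ)) :
    ENNReal.ofReal (I t / 8) ≤
      minimaxRisk q r σ ν X fun B B' => I (frobSq (G B - G B') / ρ) := by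
  have hσ := hmod.σ_pos
  -- At this scale the curvature condition bounds the divergence by `κ ‖C‖² / (2σ²) ≤ log M / 8`,
  -- the threshold of the testing argument.
  obtain ⟨ι, _, C, h2, hC, hn, hs⟩ := hpack (σ ^ 2 / (4 * κ)) (by positivity)
  refine le_minimaxRisk_of_separated hmod h2 (fun i => J (C i)) (fun i => hJ _ (hC i))
    (fun i => ?_) G hG (s := μ * (σ ^ 2 / (4 * κ) * τ)) (fun i j hij => ?_) hI ht hIt hρ ?_
  · have h1 := hcurv (C i) (hC i) 0
    have h3 : D₂ 0 (C i) = frobSq (C i) / 2 := by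
      rw [D₂, zero_sub]
      simp [frobSq]
    rw [h3] at h1
    have h4 := mul_le_mul_of_nonneg_left (hn i) hκ.le
    have h5 : κ * (σ ^ 2 / (4 * κ) * Real.log (Fintype.card ι)) =
        Real.log (Fintype.card ι) / 4 * σ ^ 2 := by field_simp
    rw [hZ]
    have hσ2 : 0 < σ ^ 2 := by positivity
    refine le_of_mul_le_mul_right ?_ hσ2
    linarith
  · exact (mul_le_mul_of_nonneg_left (hs i j hij) hμ.le).trans (hsep _ (hC i) _ (hC j))
  · refine htρ.trans (le_of_eq ?_)
    field_simp
    ring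

theorem le_minimaxRisk_estimation (hmod : IsModel q r σ ν X) {κ τ : ℝ} (hκ : 0 < κ)
    (hcurv : CurvatureBound σ ν X (signalClass p m q r) κ)
    (hpack : HasPacking (signalClass p m q r) τ)
    {I : ℝ → ℝ} (hI : MonotoneOn I (Set.Ici 0)) {t ρ : ℝ} (ht : 0 ≤ t) (hIt : 0 ≤ I t)
    (hρ : 0 < ρ) (htρ : t * ρ ≤ σ ^ 2 * τ / (16 * κ)) :
    ENNReal.ofReal (I t / 8) ≤ minimaxRisk q r σ ν X fun B B' => I (frobSq (B - B') / ρ) :=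
  le_minimaxRisk_of_hasPacking hmod hpack id (fun _ h => h) (fun _ => rfl) hκ hcurv id
    measurable_id one_pos (fun C _ C' _ => (one_mul _).le) hI ht hIt hρ (by rwa [one_mul])

theorem le_minimaxRisk_prediction (hmod : IsModel q r σ ν X) {κlo κhi τ : ℝ}
    (hcond : CondNumberBound σ ν X (signalClass p m q r) κlo κhi)
    (hpack : HasPacking (signalClass p m q r) τ)
    {I : ℝ → ℝ} (hI : MonotoneOn I (Set.Ici 0)) {t ρ : ℝ} (ht : 0 ≤ t) (hIt : 0 ≤ I t)
    (hρ : 0 < ρ) (htρ : t * ρ ≤ κlo * σ ^ 2 * τ / (16 * κhi)) :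
    ENNReal.ofReal (I t / 8) ≤
      minimaxRisk q r σ ν X fun B B' => I (frobSq (X * B - X * B') / ρ) := by
  refine le_minimaxRisk_of_hasPacking hmod hpack id (fun _ h => h) (fun _ => rfl) hcond.hi_pos
    hcond.upper (fun B => X * B) (measurable_const_mul_matrix X) hcond.lo_pos
    (fun C hC C' hC' => ?_) hI ht hIt hρ htρ
  have := hcond.lower C hC C' hC'
  simp only [D₂] at this
  simp only [id]
  linarith

/-- Every coefficient matrix `C` of the reduced design lifts to a signal with the same prediction,
supported on `rank X` rows. With the zero row this makes at most `rank X + 1 ≤ q` distinct rows, so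
the row constraint does not restrict `C`. -/
theorem le_minimaxRisk_prediction_of_svd (hmod : IsModel q r σ ν X) {κlo κhi τ : ℝ}
    (hrank : X.rank < q) {U : Matrix (Fin n) (Fin X.rank) ℝ} {d : Fin X.rank → ℝ}
    {V : Matrix (Fin p) (Fin X.rank) ℝ} (hsvd : IsCompactSVD X U d V)
    (hcond : CondNumberBound σ ν (U * Matrix.diagonal d)
      {C : Matrix (Fin X.rank) (Fin m) ℝ | C.rank ≤ r} κlo κhi)
    (hpack : HasPacking {C : Matrix (Fin X.rank) (Fin m) ℝ | C.rank ≤ r} τ)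
    {I : ℝ → ℝ} (hI : MonotoneOn I (Set.Ici 0)) {t ρ : ℝ} (ht : 0 ≤ t) (hIt : 0 ≤ I t)
    (hρ : 0 < ρ) (htρ : t * ρ ≤ κlo * σ ^ 2 * τ / (16 * κhi)) :
    ENNReal.ofReal (I t / 8) ≤
      minimaxRisk q r σ ν X fun B B' => I (frobSq (X * B - X * B') / ρ) := by
  obtain ⟨f, R, hf, hR⟩ := exists_rowEmbedding_mul_eq_one hsvd.V_orth
  have hX : ∀ C : Matrix (Fin X.rank) (Fin m) ℝ,
      X * (rowEmbedding f * (R * C)) = U * Matrix.diagonal d * C := by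
    intro C
    have h1 : X * (rowEmbedding f * (R * C)) =
        U * Matrix.diagonal d * V.transpose * (rowEmbedding f * (R * C)) :=
      congrArg (· * (rowEmbedding f * (R * C))) hsvd.eq
    rw [h1, ← Matrix.mul_assoc (rowEmbedding f), Matrix.mul_assoc _ V.transpose,
      ← Matrix.mul_assoc V.transpose, hR, Matrix.one_mul]
  refine le_minimaxRisk_of_hasPacking hmod hpack (fun C => rowEmbedding f * (R * C))
    (fun C hC => ⟨(numDistinctRows_rowEmbedding_mul_le hf _).trans hrank, ?_⟩) hX hcond.hi_pos
    hcond.upper (fun B => X * B) (measurable_const_mul_matrix X) hcond.lo_pos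
    (fun C hC C' hC' => ?_) hI ht hIt hρ htρ
  · exact (Matrix.rank_mul_le_right _ _).trans ((Matrix.rank_mul_le_right _ _).trans hC)
  · have := hcond.lower C hC C' hC'
    simp only [D₂] at this
    simp only [hX]
    linarith

end MinimaxBounds

end CRL

end

/-! ### Assembly and constants -/

open CRL in
theorem theorem1 :
    (∀ I : ℝ → ℝ, IsLossFunction I →
      ∃ c : ℝ, 0 < c ∧ ∃ c' : ℝ, 0 < c' ∧
      ∀ (n p m q r : ℕ) (σ : ℝ) (ν : Measure (Matrix (Fin n) (Fin m) ℝ))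
        (X : Matrix (Fin n) (Fin p) ℝ), IsModel q r σ ν X →
        -- (a) estimation error
        (∀ κ : ℝ, 0 < κ → CurvatureBound σ ν X (signalClass p m q r) κ →
          (∀ b ζ : ℕ, Admissible q r b ζ →
            ENNReal.ofReal c' ≤ minimaxRisk q r σ ν X fun B B' =>
              I (frobSq (B - B') / (c * σ ^ 2 * generalRate p m q r b ζ / κ))) ∧
          (8 ≤ q → (q : ℝ) ≤ Real.exp r →
            ENNReal.ofReal c' ≤ minimaxRisk q r σ ν X fun B B' =>
              I (frobSq (B - B') / (c * σ ^ 2 * complexityP p m q r / κ)))) ∧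
        -- (b) prediction error, `q ≤ rank X`
        (q ≤ X.rank → ∀ κlo κhi : ℝ, CondNumberBound σ ν X (signalClass p m q r) κlo κhi →
          ∀ b ζ : ℕ, Admissible q r b ζ →
            ENNReal.ofReal c' ≤ minimaxRisk q r σ ν X fun B B' =>
              I (frobSq (X * B - X * B') /
                (c * (κlo / κhi) * σ ^ 2 * generalRate p m q r b ζ))) ∧
        -- (b) prediction error, `q > rank X`
        (X.rank < q → r ≤ X.rank →
          ∀ (U : Matrix (Fin n) (Fin X.rank) ℝ) (d : Fin X.rank → ℝ)
            (V : Matrix (Fin p) (Fin X.rank) ℝ), IsCompactSVD X U d V →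
          ∀ κlo κhi : ℝ,
            CondNumberBound σ ν (U * Matrix.diagonal d)
              {C : Matrix (Fin X.rank) (Fin m) ℝ | C.rank ≤ r} κlo κhi →
            ENNReal.ofReal c' ≤ minimaxRisk q r σ ν X fun B B' =>
              I (frobSq (X * B - X * B') /
                (c * (κlo / κhi) * σ ^ 2 * (((X.rank : ℝ) + m) * r))))) ∧
    -- (b) mean squared prediction error, `8 ≤ q ≤ e^r` and `q ≤ rank X`
    (∃ c : ℝ, 0 < c ∧
      ∀ (n p m q r : ℕ) (σ : ℝ) (ν : Measure (Matrix (Fin n) (Fin m) ℝ))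
        (X : Matrix (Fin n) (Fin p) ℝ), IsModel q r σ ν X →
        8 ≤ q → (q : ℝ) ≤ Real.exp r → q ≤ X.rank →
        ∀ κlo κhi : ℝ, CondNumberBound σ ν X (signalClass p m q r) κlo κhi →
          ENNReal.ofReal (c * (κlo / κhi) * σ ^ 2 * complexityP p m q r) ≤
            minimaxRisk q r σ ν X fun B B' => frobSq (X * B - X * B')) := by
  have hP : ∀ {n p m q r : ℕ} {σ : ℝ} {ν : Measure (Matrix (Fin n) (Fin m) ℝ)}
      {X : Matrix (Fin n) (Fin p) ℝ}, IsModel q r σ ν X → 8 ≤ q → (q : ℝ) ≤ Real.exp r →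
      HasPacking (signalClass p m q r) (complexityP p m q r / 115200) ∧
        0 < complexityP p m q r := by
    intro n p m q r σ ν X hmod hq hqr
    obtain ⟨b, ζ, hadm, hle, hpos⟩ :=
      exists_admissible_complexityP_le hmod.two_le_r hmod.r_le_q hq hqr p m
    exact ⟨(hasPacking_signalClass hmod.two_le_r hmod.r_le_q hmod.q_le_p hmod.r_le_m hadm).mono
      le_rfl (by linarith), hpos⟩
  constructor
  · intro I hI
    obtain ⟨t, ht, hIt⟩ := hI.exists_pos
    -- The packing constant `384` would only require `6144 = 16 · 384`; the larger `1843200 = 6144 ·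
    -- 300` lets the same `c` serve the rate `P(q, r)`. The factor `1 / t` moves the threshold of
    -- the loss to a point where `I` is positive.
    have hscale : ∀ {K R : ℝ}, 0 < K → 0 < R →
        t * (1 / (1843200 * t) * K * R) ≤ K * R / 6144 := by
      intro K R hK hR
      have h1 : t * (1 / (1843200 * t) * K * R) = K * R / 1843200 := by field_simp
      have h2 : 0 < K * R := mul_pos hK hR
      rw [h1]
      linarith
    refine ⟨1 / (1843200 * t), by positivity, I t / 8, by positivity, ?_⟩
    intro n p m q r σ ν X hmod
    have hσ := hmod.σ_pos
    refine ⟨fun κ hκ hcurv => ⟨fun b ζ hadm => ?_, fun hq hqr => ?_⟩, fun _ κlo κhi hcond b ζ hadm => ?_,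
      fun hrank hr U d V hsvd κlo κhi hcond => ?_⟩
    · have hR := generalRate_pos hmod.two_le_r hmod.r_le_q p m b ζ
      have hpack := hasPacking_signalClass hmod.two_le_r hmod.r_le_q hmod.q_le_p hmod.r_le_m hadm
      refine le_minimaxRisk_estimation hmod hκ hcurv hpack hI.mono ht.le hIt.le (by positivity) ?_
      have := hscale (K := σ ^ 2 / κ) (by positivity) hR
      calc _ = t * (1 / (1843200 * t) * (σ ^ 2 / κ) * generalRate p m q r b ζ) := by ring
        _ ≤ _ := this
        _ = _ := by field_simp; ring
    · obtain ⟨hpack, hR⟩ := hP hmod hq hqr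
      refine le_minimaxRisk_estimation hmod hκ hcurv hpack hI.mono ht.le hIt.le (by positivity)
        (le_of_eq ?_)
      field_simp
      ring
    · have hR := generalRate_pos hmod.two_le_r hmod.r_le_q p m b ζ
      have hpack := hasPacking_signalClass hmod.two_le_r hmod.r_le_q hmod.q_le_p hmod.r_le_m hadm
      have hlo := hcond.lo_pos
      have hhi := hcond.hi_pos
      refine le_minimaxRisk_prediction hmod hcond hpack hI.mono ht.le hIt.le (by positivity) ?_
      have := hscale (K := κlo / κhi * σ ^ 2) (by positivity) hR
      calc _ = t * (1 / (1843200 * t) * (κlo / κhi * σ ^ 2) * generalRate p m q r b ζ) := by ring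
        _ ≤ _ := this
        _ = _ := by field_simp; ring
    · have hr0 : (0 : ℝ) < r := by exact_mod_cast (by have := hmod.two_le_r; omega : 0 < r)
      have hk0 : (0 : ℝ) < X.rank := by
        exact_mod_cast (by have := hmod.two_le_r; omega : 0 < X.rank)
      have hpack := hasPacking_rank_le (k := X.rank) (m := m)
        (by have := hmod.two_le_r; omega) hr hmod.r_le_m
      have hlo := hcond.lo_pos
      have hhi := hcond.hi_pos
      refine le_minimaxRisk_prediction_of_svd hmod hrank hsvd hcond hpack hI.mono ht.le hIt.le
        (by positivity) ?_
      have := hscale (K := κlo / κhi * σ ^ 2) (R := ((X.rank : ℝ) + m) * r) (by positivity)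
        (by positivity)
      calc _ = t * (1 / (1843200 * t) * (κlo / κhi * σ ^ 2) * (((X.rank : ℝ) + m) * r)) := by ring
        _ ≤ _ := this
        _ = _ := by field_simp; ring
  · refine ⟨1 / 14745600, by norm_num, ?_⟩
    intro n p m q r σ ν X hmod hq hqr _ κlo κhi hcond
    obtain ⟨hpack, hR⟩ := hP hmod hq hqr
    have hlo := hcond.lo_pos
    have hhi := hcond.hi_pos
    have hσ := hmod.σ_pos
    have ht : 0 ≤ 1 / 1843200 * (κlo / κhi) * σ ^ 2 * complexityP p m q r := by positivity
    have := le_minimaxRisk_prediction hmod hcond hpack (I := id) (monotone_id.monotoneOn _) ht ht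
      one_pos (le_of_eq (by field_simp; ring))
    simp only [id, div_one] at this
    refine le_trans (ENNReal.ofReal_le_ofReal (le_of_eq ?_)) this
    ring
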